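/- **Codes.** All codes are linear. An $(r,\delta,s)$ maximally recoverable (MR, or partial MDS) code over $\mathbb F_q$ is an $[m(r+\delta),\,mr-s]$ code whose symbols can be arranged in an $m\times(r+\delta)$ array so that each row is an $[r+\delta,r,\delta+1]$ MDS code and, after puncturing any $\delta$ symbols from each row, the code becomes an $[mr,mr-s]$ MDS code. For a prime power $q$ with $3\mid q-1$, a primitive element $\alpha$ of $\mathbb F_q$, $H=\{x\in\mathbb F_q:x^3=1\}$ and $A_i=\alpha^{i-1}H$ for $1\le i\le\frac{q-1}{3}$, let $\mathcal C_D$ be the Tamo–Barg code with $r=2$, $k=2D+1$, $n=q-1$: the evaluations at all points of $\bigcup_iA_i=\mathbb F_q^{*}$ of the polynomials $\sum_{j=0}^{D-1}(a_{0j}x^{3j}+a_{1j}x^{3j+1})+a_{0D}x^{3D}$ with coefficients in $\mathbb F_q$. For positive integers $N,D$ put $$Q(N,D)=2\sum_{j=2}^{2D}\lfloor j\,g(j)\rfloor\binom{\frac N3-1}{j}3^{j}+N-2,$$ where $g(j)=1$ if $j$ is even and $4\le j\le 2(D-1)$, and $g(j)=\tfrac12$ otherwise. **Theorem.** 1. Let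 $N,D$ be positive integers with $3\mid N$ and $\frac{2D}{N}<\frac23$, and let $q$ be a prime power with $3\mid q-1$ and $q>Q(N,D)$. Then, for every primitive element $\alpha$, there is a set of $\frac{q-1}{3}-\frac N3$ cosets $A_i$ such that puncturing $\mathcal C_D$ at the coordinates in these cosets gives a $(2,1,N-k-\frac N3)$ MR code over $\mathbb F_q$ of block length $N$ and dimension $k=2D+1$. 2. There is an absolute constant $K>0$ such that for all positive integers $m$, all integers $D\geq 0$ and all real $0<y<2$ with $2D=(2-y)m$ there is a prime power $q$ with $3\mid q-1$ and $q>Q(3m,D)$, so that the conclusion of part 1 holds over $\mathbb F_q$ with $N=3m$, and with $$q\le K(m-1)4^{m-1}\ \text{ if }0<y\le1,\qquad q\le K\,m^{2}\,e_1(y)^m\ \text{ if }1<y<2,$$ where $e_1(y)=\max_{0<\gamma\le 2-y}\dfrac{3^\gamma}{\gamma^\gamma(1-\gamma)^{1-\gamma}}$. 3. (The case $y=2$, i.e. $k=1$, $D=0$.) Let $m\ge1$, $N=3m$, and let $q$ be a prime power with $3\mid q-1$ and $q\ge N+1$ (for instance $q=N+1$ when $N+1$ is a prime power). Then puncturing $\mathcal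 C_0$ at any $\frac{q-1}{3}-m$ of the cosets gives an $[N,1]$ code for which there is an $m\times N$ matrix $H_0$, whose rows have exactly the $m$ remaining cosets as supports, such that the code is maximally recoverable with respect to $H_0$: $H_0$ has rank $m$, $1\le N-m$, $H_0$ annihilates the code, and every one-element set of coordinates whose complement meets the support of every nonzero vector of the row space of $H_0$ is an information set. 4. For $1.3\le y<2$ (that is, for rates asymptotically up to about $0.233$), $e_1(y)<4$ and $e_1(y)<e_2(y)$, where $e_2(y)=\dfrac{27}{(2-y)^{2-y}(1+y)^{1+y}}$. -/

import Mathlib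

open Polynomial

/-- The linear code obtained from `C` by keeping only the coordinates in `S`
(that is, by puncturing `C` in all coordinates outside `S`). -/
def restrictTo {F ι : Type*} [Field F] (C : Submodule F (ι → F)) (S : Finset ι) :
    Submodule F (S → F) :=
  C.map (LinearMap.funLeft F F (Subtype.val : S → ι))

open Classical in
/-- Minimum distance of a linear code: the least Hamming weight of a nonzero codeword
(with value `0` for the zero code). -/
noncomputable def minDist {F ι : Type*} [Field F] [Fintype ι] (C : Submodule F (ι → F)) : ℕ :=
  sInf {d | ∃ c ∈ C, c ≠ 0 ∧ hammingNorm c = d}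

/-- `C` is an `[n, k]` code. -/
def IsLinearCode {F ι : Type*} [Field F] [Fintype ι] (n k : ℕ) (C : Submodule F (ι → F)) : Prop :=
  Fintype.card ι = n ∧ Module.finrank F C = k

/-- `C` is an `[n, k]` MDS code, i.e. an `[n, k, n - k + 1]` code. -/
def IsMDSCode {F ι : Type*} [Field F] [Fintype ι] (n k : ℕ) (C : Submodule F (ι → F)) : Prop :=
  IsLinearCode n k C ∧ minDist C + k = n + 1

/-- `(r, δ, s)` maximally recoverable (partial MDS) code: an `[m (r + δ), m r - s]` code whose
symbols can be arranged as an `m × (r + δ)` array such that every row is an `[r + δ, r, δ + 1]` MDS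
code, and puncturing any `δ` symbols from each row leaves an `[m r, m r - s]` MDS code. -/
def IsMRCode {F ι : Type*} [Field F] [Fintype ι] (r δ s : ℕ) (C : Submodule F (ι → F)) : Prop :=
  ∃ m k : ℕ, k + s = m * r ∧ IsLinearCode (m * (r + δ)) k C ∧
    ∃ e : ι ≃ Fin m × Fin (r + δ),
      (∀ i : Fin m, IsMDSCode (r + δ) r (restrictTo C {x : ι | (e x).1 = i})) ∧
      ∀ P : Fin m → Finset (Fin (r + δ)), (∀ i, (P i).card = δ) →
        IsMDSCode (m * r) k (restrictTo C {x : ι | (e x).2 ∉ P (e x).1})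

/-- Maximal recoverability with respect to a full-rank matrix `H₀` of prescribed parity checks:
`C` is an `[n, k]` code with `k ≤ n - ρ`, annihilated by `H₀`, and every `k`-core `S` (a set of `k`
coordinates whose complement meets the support of every nonzero vector of the row space of `H₀`)
is an information set of `C`. -/
def IsMRWithRespectTo {F ι κ : Type*} [Field F] [Fintype ι] [Fintype κ]
    (H₀ : Matrix κ ι F) (k : ℕ) (C : Submodule F (ι → F)) : Prop :=
  H₀.rank = Fintype.card κ ∧ Module.finrank F C = k ∧ k + Fintype.card κ ≤ Fintype.card ι ∧
    (∀ c ∈ C, H₀.mulVec c = 0) ∧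
    ∀ S : Finset ι, S.card = k →
      (∀ v ∈ Submodule.span F (Set.range H₀.row), v ≠ 0 → ∃ i ∉ S, v i ≠ 0) →
      Module.finrank F (restrictTo C S) = k

/-- The encoding polynomial
`∑_{j < a} ∑_{i < r} A_{ij} x^{j(r+1)+i} + ∑_{i < b} B_i x^{a(r+1)+i}`
of the message `(A, B)` of `a r + b` symbols. -/
noncomputable def messagePoly {F : Type*} [Field F] (r a b : ℕ)
    (M : (Fin a → Fin r → F) × (Fin b → F)) : F[X] :=
  (∑ j : Fin a, ∑ i : Fin r, C (M.1 j i) * X ^ ((j : ℕ) * (r + 1) + (i : ℕ))) +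
    ∑ i : Fin b, C (M.2 i) * X ^ (a * (r + 1) + (i : ℕ))

/-- Evaluation points. With `α` primitive and `β = α ^ ((q - 1) / (r + 1))`, the points `(i, 0), …,
(i, r)` run through the coset `α ^ i H`, where `H = {1, β, …, β ^ r}`. -/
def evalPoint {F : Type*} [Field F] [Fintype F] (α : Fˣ) (r m : ℕ) (p : Fin m × Fin (r + 1)) : F :=
  ((α ^ (p.1 : ℕ) * (α ^ ((Fintype.card F - 1) / (r + 1))) ^ (p.2 : ℕ) : Fˣ) : F)

/-- The Tamo-Barg encoder with `m` cosets of the group of `(r + 1)`-th roots of unity. -/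
noncomputable def tamoBargEncoder {F : Type*} [Field F] [Fintype F] (α : Fˣ) (r m a b : ℕ) :
    ((Fin a → Fin r → F) × (Fin b → F)) →ₗ[F] (Fin m × Fin (r + 1) → F) where
  toFun M p := (messagePoly r a b M).eval (evalPoint α r m p)
  map_add' M M' := by
    funext p
    simp only [messagePoly, eval_add, eval_finsetSum, eval_mul, eval_C, eval_pow, eval_X,
      Pi.add_apply, Prod.fst_add, Prod.snd_add, add_mul, Finset.sum_add_distrib]
    ring
  map_smul' c M := by
    funext p
    simp only [messagePoly, eval_add, eval_finsetSum, eval_mul, eval_C, eval_pow, eval_X,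
      Pi.smul_apply, Prod.smul_fst, Prod.smul_snd, smul_eq_mul, RingHom.id_apply, mul_add,
      Finset.mul_sum, mul_assoc]

/-- The Tamo-Barg code of length `m (r + 1)` with `a r + b` message symbols. -/
noncomputable def tamoBargCode {F : Type*} [Field F] [Fintype F] (α : Fˣ) (r m a b : ℕ) :
    Submodule F (Fin m × Fin (r + 1) → F) :=
  LinearMap.range (tamoBargEncoder α r m a b)

/-- The Tamo-Barg code over `F` with `r = 2`, `a = D`, `b = 1` and length `q - 1` (all cosets of the
cube roots of unity), punctured at the cosets `α ^ i H`, `i ∈ T`. -/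
noncomputable def puncturedTamoBarg {F : Type*} [Field F] [Fintype F] (α : Fˣ) (D : ℕ)
    (T : Finset (Fin ((Fintype.card F - 1) / 3))) :
    Submodule F (({p | p.1 ∉ T} : Finset (Fin ((Fintype.card F - 1) / 3) × Fin (2 + 1))) → F) :=
  restrictTo (tamoBargCode α 2 ((Fintype.card F - 1) / 3) D 1) {p | p.1 ∉ T}

/-- For every primitive element `α` of `F`, one can puncture the Tamo-Barg code (`r = 2`,
`k = 2 D + 1`, length `q - 1`) at `(q - 1) / 3 - N / 3` cosets so as to get a
`(2, 1, N - k - N / 3)` maximally recoverable code of block length `N` and dimension `2 D + 1`. -/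
def HasMRPuncturing (F : Type*) [Field F] [Fintype F] (N D : ℕ) : Prop :=
  ∀ α : Fˣ, (∀ x : Fˣ, x ∈ Subgroup.zpowers α) →
    ∃ T : Finset (Fin ((Fintype.card F - 1) / 3)),
      T.card + N / 3 = (Fintype.card F - 1) / 3 ∧
      IsLinearCode N (2 * D + 1) (puncturedTamoBarg α D T) ∧
      IsMRCode 2 1 (N - (2 * D + 1) - N / 3) (puncturedTamoBarg α D T)

/-- The weight `g(j)`. -/
def gWeight (D j : ℕ) : ℚ :=
  if Even j ∧ 4 ≤ j ∧ j ≤ 2 * (D - 1) then 1 else 1 / 2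

/-- `2 ∑_{j=2}^{2D} ⌊j g(j)⌋ (N/3 - 1 choose j) 3^j + N - 2`. -/
def fieldSizeThreshold (N D : ℕ) : ℤ :=
  2 * (∑ j ∈ Finset.Icc 2 (2 * D), ⌊(j : ℚ) * gWeight D j⌋ * ((N / 3 - 1).choose j : ℤ) * 3 ^ j)
    + (N : ℤ) - 2

/-- `3^γ / (γ^γ (1 - γ)^(1 - γ))`. -/
noncomputable def cosetGrowth (γ : ℝ) : ℝ :=
  (3 : ℝ) ^ γ / (γ ^ γ * (1 - γ) ^ (1 - γ))

/-- `e₁(y) = max_{0 < γ ≤ 2 - y} 3^γ / (γ^γ (1 - γ)^(1 - γ))`. -/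
noncomputable def growthE1 (y : ℝ) : ℝ :=
  sSup (cosetGrowth '' Set.Ioc 0 (2 - y))

/-- `e₂(y) = 27 / ((2 - y)^(2 - y) (1 + y)^(1 + y))`. -/
noncomputable def growthE2 (y : ℝ) : ℝ :=
  27 / ((2 - y) ^ (2 - y) * (1 + y) ^ (1 + y))

/-- The supremum defining `e₁(y)` is a maximum. -/
theorem growthE1_isGreatest {y : ℝ} (h1 : 1 ≤ y) (h2 : y < 2) :
    IsGreatest (cosetGrowth '' Set.Ioc 0 (2 - y)) (growthE1 y) := by
  have key : ∀ γ ∈ Set.Icc (0 : ℝ) 1, cosetGrowth γ =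
      Real.exp (γ * Real.log 3 + Real.negMulLog γ + Real.negMulLog (1 - γ)) := by
    have aux : ∀ t : ℝ, 0 ≤ t → t ^ t = Real.exp (-Real.negMulLog t) := by
      intro t ht
      rcases ht.eq_or_lt with h | h
      · subst h; simp
      · rw [Real.rpow_def_of_pos h, Real.negMulLog]; congr 1; ring
    intro γ hγ
    rw [cosetGrowth, aux γ hγ.1, aux (1 - γ) (by linarith [hγ.2]),
      Real.rpow_def_of_pos (by norm_num), ← Real.exp_add, ← Real.exp_sub]
    congr 1; ring
  have hcont : Continuous fun γ : ℝ =>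
      Real.exp (γ * Real.log 3 + Real.negMulLog γ + Real.negMulLog (1 - γ)) := by
    have := Real.continuous_negMulLog
    fun_prop
  obtain ⟨γ, hγ, hmax⟩ := (isCompact_Icc (a := (0 : ℝ)) (b := 2 - y)).exists_isMaxOn
    ⟨0, by simp; linarith⟩ hcont.continuousOn
  have hpos : γ ≠ 0 := by
    rintro rfl
    have h := hmax (show 2 - y ∈ Set.Icc 0 (2 - y) by constructor <;> linarith)
    simp only [Set.mem_ofPred_eq, Real.exp_le_exp] at h
    have a := Real.negMulLog_nonneg (x := 2 - y) (by linarith) (by linarith)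
    have b := Real.negMulLog_nonneg (x := 1 - (2 - y)) (by linarith) (by linarith)
    have c : 0 < (2 - y) * Real.log 3 := mul_pos (by linarith) (Real.log_pos (by norm_num))
    simp at h a b c
    linarith
  have hG : IsGreatest (cosetGrowth '' Set.Ioc 0 (2 - y)) (cosetGrowth γ) := by
    refine ⟨⟨γ, ⟨lt_of_le_of_ne hγ.1 hpos.symm, hγ.2⟩, rfl⟩, ?_⟩
    rintro _ ⟨x, hx, rfl⟩
    rw [key x ⟨hx.1.le, by linarith [hx.2]⟩, key γ ⟨hγ.1, by linarith [hγ.2]⟩]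
    exact hmax ⟨hx.1.le, hx.2⟩
  rw [growthE1, hG.csSup_eq]
  exact hG

/-! A codeword is the value vector of a polynomial whose exponents avoid 2 mod 3. Maximal
recoverability asks that such a polynomial in `gapPoly F (2 * D + 1)` be zero once it has `2 * D +
1` zeros, at most two per coset. Two zeros in one coset force a factor `X ^ 3 - c`, constant on
cosets, whose cofactor lies in `gapPoly` with index lowered by two (`exists_eq_mul_of_two_roots`).
Splitting off such pairs leaves zeros in distinct cosets, so it suffices that the cosets kept are in
general position (`IsGeneric`, `IsGeneric.eq_zero`).

Such cosets are found greedily. For a chosen set `J` of cosets and one point in each, general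
position makes the polynomial in `gapPoly F (J.card + 1)` vanishing there unique up to scalars. Its
degree is at most `J.card + J.card / 2`, so it has at most `J.card / 2` further zeros, and only
these obstruct (`card_obstructed_le`). Multiplication by cube roots of unity spreads an obstruction
over all three points of its coset, so each bad coset is counted three times
(`three_mul_card_bad_le`). A field above the threshold therefore always leaves a free coset
(`exists_isGeneric`).

The field size bounds take `q` to be a power of 4 and estimate the binomial sum, either by the full
sum `4 ^ (m - 1)` or termwise by `cosetGrowth`. For `D = 0` the code is a repetition code, checked
on each coset by `1 + β + β ^ 2 = 0`. -/

/-- Polynomials supported on the first `n` exponents `0, 1, 3, 4, 6, …` that are not `2` mod `3`. -/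
def gapPoly (F : Type*) [Field F] (n : ℕ) : Submodule F F[X] where
  carrier := {f | ∀ d, f.coeff d ≠ 0 → ∃ i < n, d = i + i / 2}
  add_mem' {f g} hf hg d hd := by
    by_cases h : f.coeff d = 0
    · exact hg d fun h' => hd (by rw [coeff_add, h, h', add_zero])
    · exact hf d h
  zero_mem' d hd := by simp at hd
  smul_mem' c f hf d hd := hf d fun h => hd (by rw [coeff_smul, h, smul_zero])

/-! ### Division by `X ^ 3 - c` among polynomials without exponents 2 mod 3. -/

section gapPoly

variable {F : Type*} [Field F]

theorem mem_gapPoly_iff {n : ℕ} {f : F[X]} :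
    f ∈ gapPoly F n ↔ ∀ d, f.coeff d ≠ 0 → d % 3 ≠ 2 ∧ d < n + n / 2 := by
  refine forall_congr' fun d => imp_congr_right fun _ => ⟨?_, fun h => ⟨d - d / 3, ?_, ?_⟩⟩
  · rintro ⟨i, hi, rfl⟩
    omega
  · omega
  · omega

theorem gapPoly_zero {f : F[X]} (hf : f ∈ gapPoly F 0) : f = 0 := by
  ext d
  by_contra h
  obtain ⟨i, hi, -⟩ := hf d h
  omega

theorem natDegree_le_of_mem_gapPoly {n : ℕ} {f : F[X]} (hf : f ∈ gapPoly F (n + 1)) :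
    f.natDegree ≤ n + n / 2 := by
  refine natDegree_le_iff_coeff_eq_zero.2 fun d hd => ?_
  by_contra h
  obtain ⟨i, hi, rfl⟩ := hf d h
  omega

theorem mem_gapPoly_of_coeff_eq_zero {n : ℕ} {f : F[X]} (hf : f ∈ gapPoly F (n + 1))
    (h : f.coeff (n + n / 2) = 0) : f ∈ gapPoly F n := by
  intro d hd
  obtain ⟨i, hi, rfl⟩ := hf d hd
  refine ⟨i, lt_of_le_of_ne (Nat.lt_succ_iff.1 hi) ?_, rfl⟩
  rintro rfl
  exact hd h

theorem scale_mem_gapPoly {n : ℕ} {f : F[X]} (hf : f ∈ gapPoly F n) (c : F) :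
    f.comp (C c * X) ∈ gapPoly F n := by
  intro d hd
  rw [comp_C_mul_X_coeff] at hd
  exact hf d (left_ne_zero_of_mul hd)

/-- A polynomial without exponents `2` mod `3` that vanishes at two points with the same cube `c`
is divisible by `X ^ 3 - c`, and the quotient again has no such exponents. -/
theorem exists_eq_mul_of_two_roots {n : ℕ} {f : F[X]} (hf : f ∈ gapPoly F (n + 2)) {x y : F}
    (hxy : x ≠ y) (h3 : x ^ 3 = y ^ 3) (hx : f.eval x = 0) (hy : f.eval y = 0) :
    ∃ g ∈ gapPoly F n, f = (X ^ 3 - C (x ^ 3)) * g := by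
  set c := x ^ 3 with hc
  have hm : (X ^ 3 - C c : F[X]).Monic := monic_X_pow_sub_C c (by norm_num)
  have hdm : (X ^ 3 - C c : F[X]).natDegree = 3 := natDegree_X_pow_sub_C
  set g := f /ₘ (X ^ 3 - C c) with hg
  set r := f %ₘ (X ^ 3 - C c) with hr
  have hfg : r + (X ^ 3 - C c) * g = f := modByMonic_add_div f _
  have hrdeg : r.natDegree < 3 := by
    rw [← hdm]
    exact natDegree_modByMonic_lt f hm fun h => by rw [h] at hdm; simp at hdm
  have hrc : ∀ d, 3 ≤ d → r.coeff d = 0 := fun d hd =>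
    coeff_eq_zero_of_natDegree_lt (by omega)
  have hfc := mem_gapPoly_iff.1 hf
  have hgdeg : g.natDegree = f.natDegree - 3 := by rw [hg, natDegree_divByMonic f hm, hdm]
  -- Comparing coefficients in `f = r + (X ^ 3 - c) g` gives a recursion that runs separately in
  -- each residue class mod 3.
  have hrec : ∀ d, f.coeff (d + 3) = g.coeff d - c * g.coeff (d + 3) := by
    intro d
    rw [← hfg, coeff_add, hrc _ (by omega), sub_mul, coeff_sub, coeff_C_mul, mul_comm (X ^ 3) g,
      coeff_mul_X_pow, zero_add]
  -- Descending induction within the class 2 mod 3: `t` bounds the distance from `d` up to the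
  -- degree of `f`, beyond which `g` has no coefficients.
  have hgc : ∀ t d, d % 3 = 2 → f.natDegree ≤ d + t → g.coeff d = 0 := by
    intro t
    induction t with
    | zero =>
      intro d hd ht
      have := hrec d
      rw [coeff_eq_zero_of_natDegree_lt (p := f) (by omega),
        coeff_eq_zero_of_natDegree_lt (p := g) (n := d + 3) (by omega)] at this
      simpa using this.symm
    | succ t ih =>
      intro d hd ht
      have := hrec d
      have h0 : f.coeff (d + 3) = 0 := by
        by_contra h
        have := (hfc _ h).1
        omega
      rw [h0, ih (d + 3) (by omega) (by omega)] at this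
      simpa using this.symm
  -- The remainder is thus linear; its two distinct zeros `x` and `y` then make it zero.
  have hr2 : r.coeff 2 = 0 := by
    have h0 : f.coeff 2 = 0 := by
      by_contra h
      exact (hfc _ h).1 rfl
    have h2 : (X ^ 3 * g).coeff 2 = 0 := by
      rw [mul_comm, coeff_mul_X_pow', if_neg (by norm_num)]
    rw [← hfg, coeff_add, sub_mul, coeff_sub, coeff_C_mul, hgc f.natDegree 2 rfl (by omega),
      h2] at h0
    simpa using h0
  have hreval : ∀ z, z ^ 3 = c → f.eval z = 0 → r.coeff 0 + r.coeff 1 * z = 0 := by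
    intro z hz hfz
    have h1 : r.eval z = 0 := by
      rw [← hfg] at hfz
      simpa [hz] using hfz
    rw [eval_eq_sum_range' hrdeg] at h1
    simpa [Finset.sum_range_succ, hr2] using h1
  have e1 := hreval x rfl hx
  have e2 := hreval y h3.symm hy
  have hr1 : r.coeff 1 = 0 := by
    have : r.coeff 1 * (x - y) = 0 := by linear_combination e1 - e2
    exact (mul_eq_zero.1 this).resolve_right (sub_ne_zero.2 hxy)
  have hr0 : r.coeff 0 = 0 := by simpa [hr1] using e1
  have hr' : r = 0 := by
    ext d
    rcases Nat.lt_or_ge d 3 with h | h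
    · interval_cases d <;> simp [hr0, hr1, hr2]
    · simpa using hrc d h
  refine ⟨g, mem_gapPoly_iff.2 fun d hd => ⟨fun h => hd (hgc f.natDegree d h (by omega)), ?_⟩, ?_⟩
  · have h1 : f ∈ gapPoly F (n + 1 + 1) := hf
    have h2 := natDegree_le_of_mem_gapPoly h1
    have h3 := le_natDegree_of_ne_zero hd
    by_contra hlt
    -- The degree bound fails only for `n = 0`, through truncated subtraction of 3; there `f` has
    -- degree at most 1 and the recursion gives `g = 0`.
    have h4 : g.natDegree = 0 := by omega
    have h5 : n = 0 := by omega
    have h6 : d = 0 := by omega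
    subst h5 h6
    have h7 := hrec 0
    rw [coeff_eq_zero_of_natDegree_lt (p := f) (by omega),
        coeff_eq_zero_of_natDegree_lt (p := g) (n := 0 + 3) (by omega)] at h7
    exact hd (by simpa using h7.symm)
  · rw [← hfg, hr', zero_add]

end gapPoly

/-! ### Greedy choice of cosets in general position. -/

section greedy

variable {F ι : Type*} [Field F]

/-- The cosets indexed by `U` are in general position up to size `n`: no nonzero polynomial in
`gapPoly F j` vanishes at `j ≤ n` points of distinct cosets. -/
def IsGeneric (ev : ι × Fin 3 → F) (n : ℕ) (U : Finset ι) : Prop :=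
  ∀ J ⊆ U, J.card ≤ n → ∀ σ : ι → Fin 3, ∀ f ∈ gapPoly F J.card,
    (∀ i ∈ J, f.eval (ev (i, σ i)) = 0) → f = 0

/-- A nonzero polynomial in `gapPoly F (|J| + 1)` vanishes at `p` and at the points of `J` chosen
by `σ`. -/
def IsObstructed (ev : ι × Fin 3 → F) (J : Finset ι) (σ : ι → Fin 3) (p : ι × Fin 3) : Prop :=
  ∃ f ∈ gapPoly F (J.card + 1), f ≠ 0 ∧ f.eval (ev p) = 0 ∧ ∀ i ∈ J, f.eval (ev (i, σ i)) = 0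

variable {ev : ι × Fin 3 → F}

/-- Root count: the degree is at most `J.card + J.card / 2`, and `J` already accounts for `J.card`
roots. -/
theorem card_add_card_le_of_roots (hinj : Function.Injective ev) {J : Finset ι} {σ : ι → Fin 3}
    {f : F[X]} (hf : f ∈ gapPoly F (J.card + 1)) (hf0 : f ≠ 0)
    (hJ : ∀ i ∈ J, f.eval (ev (i, σ i)) = 0) {B : Finset (ι × Fin 3)}
    (hB : ∀ p ∈ B, p.1 ∉ J ∧ f.eval (ev p) = 0) : B.card ≤ J.card / 2 := by
  classical
  have hdisj : Disjoint B (J.image fun i => (i, σ i)) := by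
    rw [Finset.disjoint_right]
    intro p hp hpB
    obtain ⟨i, hi, rfl⟩ := Finset.mem_image.1 hp
    exact (hB _ hpB).1 hi
  have hsub : (B ∪ J.image fun i => (i, σ i)).image ev ⊆ f.roots.toFinset := by
    intro x hx
    obtain ⟨p, hp, rfl⟩ := Finset.mem_image.1 hx
    rw [Multiset.mem_toFinset, mem_roots hf0, IsRoot]
    rcases Finset.mem_union.1 hp with h | h
    · exact (hB p h).2
    · obtain ⟨i, hi, rfl⟩ := Finset.mem_image.1 h
      exact hJ i hi
  have h1 := Finset.card_le_card hsub
  rw [Finset.card_image_of_injective _ hinj, Finset.card_union_of_disjoint hdisj,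
    Finset.card_image_of_injective _ fun i j h => congrArg Prod.fst h] at h1
  have h2 := (Multiset.toFinset_card_le f.roots).trans (card_roots' f)
  have h3 := natDegree_le_of_mem_gapPoly hf
  omega

theorem card_obstructed_le (hinj : Function.Injective ev) {n : ℕ} {U : Finset ι}
    (hU : IsGeneric ev n U) {J : Finset ι} (hJU : J ⊆ U) (hJn : J.card ≤ n) {σ : ι → Fin 3}
    {B : Finset (ι × Fin 3)} (hB : ∀ p ∈ B, p.1 ∉ J ∧ IsObstructed ev J σ p) :
    B.card ≤ J.card / 2 := by
  rcases B.eq_empty_or_nonempty with rfl | ⟨p₀, hp₀⟩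
  · simp
  obtain ⟨f, hf, hf0, -, hfJ⟩ := (hB p₀ hp₀).2
  refine card_add_card_le_of_roots hinj hf hf0 hfJ fun p hp => ⟨(hB p hp).1, ?_⟩
  obtain ⟨g, hg, hg0, hgp, hgJ⟩ := (hB p hp).2
  set e := J.card + J.card / 2 with he
  have hge : g.coeff e ≠ 0 := fun h =>
    hg0 (hU J hJU hJn σ g (mem_gapPoly_of_coeff_eq_zero hg h) hgJ)
  -- Eliminating the top exponent `e` lands in `gapPoly F J.card`, where general position forces
  -- zero. Hence `f` is a multiple of `g`, and one polynomial `f` vanishes at all obstructed points.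
  have key : g.coeff e • f - f.coeff e • g = 0 := by
    refine hU J hJU hJn σ _ (mem_gapPoly_of_coeff_eq_zero
      (Submodule.sub_mem _ (Submodule.smul_mem _ _ hf) (Submodule.smul_mem _ _ hg)) ?_) ?_
    · simp [← he, mul_comm]
    · intro i hi
      simp [hfJ i hi, hgJ i hi]
  have := congrArg (eval (ev p)) key
  simpa [hgp, hge] using this

/-- A failure of general position at the new coset is an obstruction by the remaining ones. For
`J.card ≤ 1` the bound `J.card / 2 = 0` excludes it automatically, so only sets of size at least 2
must be avoided. -/
theorem IsGeneric.insert [DecidableEq ι] (hinj : Function.Injective ev) {n : ℕ} {U : Finset ι}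
    (hU : IsGeneric ev (n + 1) U) {i : ι}
    (hbad : ∀ J ⊆ U, 2 ≤ J.card → J.card ≤ n → ∀ σ l, ¬ IsObstructed ev J σ (i, l)) :
    IsGeneric ev (n + 1) (insert i U) := by
  intro J hJ hJn σ f hf hfJ
  by_cases hiJ : i ∈ J
  · have hJ' : J.erase i ⊆ U := Finset.subset_insert_iff.1 hJ
    have hc : (J.erase i).card + 1 = J.card := Finset.card_erase_add_one hiJ
    rw [← hc] at hf
    by_contra hf0
    have hob : IsObstructed ev (J.erase i) σ (i, σ i) :=
      ⟨f, hf, hf0, hfJ i hiJ, fun k hk => hfJ k (Finset.mem_of_mem_erase hk)⟩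
    by_cases h2 : 2 ≤ (J.erase i).card
    · exact hbad _ hJ' h2 (by omega) σ _ hob
    · have := card_obstructed_le (B := {(i, σ i)}) hinj hU hJ' (by omega) (σ := σ) (by
        intro p hp
        rw [Finset.mem_singleton.1 hp]
        exact ⟨Finset.notMem_erase i J, hob⟩)
      rw [Finset.card_singleton] at this
      omega
  · exact hU J ((Finset.subset_insert_iff_of_notMem hiJ).1 hJ) hJn σ f hf hfJ

/-- The rotations of the points in each coset come from scalings of the field. -/
def HasRotations (ev : ι × Fin 3 → F) : Prop :=
  ∀ l l' : Fin 3, ∃ c : F, c ≠ 0 ∧ ∃ τ : Fin 3 → Fin 3, τ l = l' ∧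
    ∀ i k, ev (i, k) = c * ev (i, τ k)

/-- The substitution `x ↦ c x` preserves exponents and permutes the points within every coset
simultaneously; only `σ` changes, not `J`. -/
theorem IsObstructed.rotate (hrot : HasRotations ev) {J : Finset ι} {σ : ι → Fin 3} {i : ι}
    {l : Fin 3} (h : IsObstructed ev J σ (i, l)) (l' : Fin 3) :
    ∃ σ', IsObstructed ev J σ' (i, l') := by
  obtain ⟨c, hc, τ, rfl, hτ⟩ := hrot l l'
  obtain ⟨f, hf, hf0, hfi, hfJ⟩ := h
  refine ⟨fun k => τ (σ k), f.comp (C c * X), scale_mem_gapPoly hf c, ?_, ?_, ?_⟩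
  · intro h
    apply hf0
    ext d
    have := congrArg (fun g => coeff g d) h
    simpa [comp_C_mul_X_coeff, hc] using this
  · simpa [← hτ] using hfi
  · intro k hk
    simpa [← hτ] using hfJ k hk

-- Double counting of pairs (bad coset, point in it): rotation makes all three points obstructed,
-- while each of the `3 ^ j` selections on a `j`-set obstructs at most `j / 2` points.
open Classical in
theorem three_mul_card_bad_le [Fintype ι] (hinj : Function.Injective ev)
    (hrot : HasRotations ev) {n N : ℕ} (hN : n ≤ N) {U : Finset ι} (hU : IsGeneric ev N U) :
    3 * (Finset.univ.filter fun i => i ∉ U ∧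
      ∃ J ⊆ U, 2 ≤ J.card ∧ J.card ≤ n ∧ ∃ σ l, IsObstructed ev J σ (i, l)).card ≤
    ∑ j ∈ Finset.Icc 2 n, (j / 2) * U.card.choose j * 3 ^ j := by
  set bad := Finset.univ.filter fun i => i ∉ U ∧
      ∃ J ⊆ U, 2 ≤ J.card ∧ J.card ≤ n ∧ ∃ σ l, IsObstructed ev J σ (i, l) with hbad
  -- Selections are normalised to 0 off `J`, so that there are exactly `3 ^ J.card` of them.
  let sel : Finset ι → Finset (ι → Fin 3) := fun J =>
    Fintype.piFinset fun i => if i ∈ J then Finset.univ else {0}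
  let B : Finset ι → (ι → Fin 3) → Finset (ι × Fin 3) := fun J σ =>
    Finset.univ.filter fun p => p.1 ∉ U ∧ IsObstructed ev J σ p
  have hsub : bad ×ˢ (Finset.univ : Finset (Fin 3)) ⊆ (Finset.Icc 2 n).biUnion fun j =>
      (U.powersetCard j).biUnion fun J => (sel J).biUnion fun σ => B J σ := by
    rintro ⟨i, l'⟩ hi
    rw [Finset.mem_product, hbad, Finset.mem_filter] at hi
    obtain ⟨⟨-, hiU, J, hJU, hJ2, hJn, σ, l, hob⟩, -⟩ := hi
    obtain ⟨σ', f, hf, hf0, hfi, hfJ⟩ := hob.rotate hrot l'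
    simp only [Finset.mem_biUnion, Finset.mem_Icc, Finset.mem_powersetCard]
    refine ⟨J.card, ⟨hJ2, hJn⟩, J, ⟨hJU, rfl⟩, fun k => if k ∈ J then σ' k else 0, ?_, ?_⟩
    · simp only [sel, Fintype.mem_piFinset]
      intro k
      split_ifs <;> simp
    · simp only [B, Finset.mem_filter, Finset.mem_univ, true_and]
      exact ⟨hiU, f, hf, hf0, hfi, fun k hk => by simpa [hk] using hfJ k hk⟩
  have hsel : ∀ J, (sel J).card = 3 ^ J.card := by
    intro J
    simp only [sel, Fintype.card_piFinset]
    rw [← Finset.prod_subset (Finset.subset_univ J) (by intro x _ hx; simp [hx]),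
      Finset.prod_congr rfl (g := fun _ => 3) (by intro x hx; simp [hx]), Finset.prod_const]
  have h1 := Finset.card_le_card hsub
  rw [Finset.card_product, Finset.card_univ, Fintype.card_fin, mul_comm] at h1
  refine h1.trans (Finset.card_biUnion_le.trans (Finset.sum_le_sum fun j hj => ?_))
  refine Finset.card_biUnion_le.trans ?_
  have h2 : ∀ J ∈ U.powersetCard j, ((sel J).biUnion fun σ => B J σ).card ≤ 3 ^ j * (j / 2) := by
    intro J hJ
    obtain ⟨hJU, rfl⟩ := Finset.mem_powersetCard.1 hJ
    refine (Finset.card_biUnion_le_card_mul _ _ (J.card / 2) fun σ _ => ?_).trans_eq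
      (by rw [hsel])
    refine card_obstructed_le hinj hU hJU ((Finset.mem_Icc.1 hj).2.trans hN) (σ := σ)
      fun p hp => ?_
    simp only [B, Finset.mem_filter] at hp
    exact ⟨fun h => hp.2.1 (hJU h), hp.2.2⟩
  refine (Finset.sum_le_sum h2).trans_eq ?_
  rw [Finset.sum_const, Finset.card_powersetCard, smul_eq_mul]
  ring

theorem exists_isGeneric [Fintype ι] (hinj : Function.Injective ev) (hrot : HasRotations ev)
    {n m : ℕ} (hm : 3 * (m - 1) + ∑ j ∈ Finset.Icc 2 n, (j / 2) * (m - 1).choose j * 3 ^ j <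
      3 * Fintype.card ι) :
    ∀ t ≤ m, ∃ U : Finset ι, U.card = t ∧ IsGeneric ev (n + 1) U := by
  classical
  intro t
  induction t with
  | zero =>
    intro _
    refine ⟨∅, rfl, fun J hJ _ σ f hf _ => ?_⟩
    rw [Finset.subset_empty.1 hJ, Finset.card_empty] at hf
    exact gapPoly_zero hf
  | succ t ih =>
    intro ht
    obtain ⟨U, rfl, hU⟩ := ih (by omega)
    have h3 := three_mul_card_bad_le hinj hrot (Nat.le_succ n) hU
    set bad := Finset.univ.filter fun i => i ∉ U ∧
      ∃ J ⊆ U, 2 ≤ J.card ∧ J.card ≤ n ∧ ∃ σ l, IsObstructed ev J σ (i, l) with hbad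
    have hmono : ∑ j ∈ Finset.Icc 2 n, (j / 2) * U.card.choose j * 3 ^ j ≤
        ∑ j ∈ Finset.Icc 2 n, (j / 2) * (m - 1).choose j * 3 ^ j := by
      gcongr
      omega
    -- At most `m - 1` cosets are used and the bad ones are bounded by the sum, so `hm` leaves a
    -- coset outside both.
    have hlt : (U ∪ bad).card < (Finset.univ : Finset ι).card := by
      have := Finset.card_union_le U bad
      rw [Finset.card_univ]
      omega
    obtain ⟨i, -, hi⟩ := Finset.exists_mem_notMem_of_card_lt_card hlt
    rw [Finset.mem_union, not_or] at hi
    refine ⟨insert i U, Finset.card_insert_of_notMem hi.1, hU.insert hinj ?_⟩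
    intro J hJU h2 hn σ l hob
    exact hi.2 (Finset.mem_filter.2 ⟨Finset.mem_univ _, hi.1, J, hJU, h2, hn, σ, l, hob⟩)

/-- A polynomial in `gapPoly F n` with `n` zeros in generic cosets, at most two in each coset,
is zero. -/
theorem IsGeneric.eq_zero [DecidableEq ι] (hinj : Function.Injective ev)
    (hcube : ∀ p p', ev p ^ 3 = ev p' ^ 3 ↔ p.1 = p'.1) {N : ℕ} {U : Finset ι}
    (hU : IsGeneric ev N U) (n : ℕ) (hn : n ≤ N) (f : F[X]) (hf : f ∈ gapPoly F n)
    (Z : Finset (ι × Fin 3)) (hZU : ∀ p ∈ Z, p.1 ∈ U) (hZn : n ≤ Z.card)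
    (hZ2 : ∀ i, (Z.filter fun p => p.1 = i).card ≤ 2) (hfZ : ∀ p ∈ Z, f.eval (ev p) = 0) :
    f = 0 := by
  induction n using Nat.strong_induction_on generalizing f Z with
  | _ n ih =>
  by_cases hZinj : Set.InjOn Prod.fst (Z : Set (ι × Fin 3))
  · obtain ⟨Z', hZ', hc⟩ := Finset.exists_subset_card_eq hZn
    have hinj' : Set.InjOn Prod.fst (Z' : Set (ι × Fin 3)) :=
      hZinj.mono (Finset.coe_subset.2 hZ')
    have hcard : (Z'.image Prod.fst).card = n := by rw [Finset.card_image_of_injOn hinj', hc]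
    have hsel : ∀ i, ∃ l, i ∈ Z'.image Prod.fst → (i, l) ∈ Z' := by
      intro i
      by_cases hi : i ∈ Z'.image Prod.fst
      · obtain ⟨⟨a, l⟩, hp, rfl⟩ := Finset.mem_image.1 hi
        exact ⟨l, fun _ => hp⟩
      · exact ⟨0, fun h => absurd h hi⟩
    choose σ hσ using hsel
    refine hU (Z'.image Prod.fst) ?_ (hcard.trans_le hn) σ f (by rwa [hcard])
      fun i hi => hfZ _ (hZ' (hσ i hi))
    intro i hi
    obtain ⟨p, hp, rfl⟩ := Finset.mem_image.1 hi
    exact hZU p (hZ' hp)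
  · simp only [Set.InjOn, not_forall] at hZinj
    obtain ⟨p, hp, p', hp', h1, hne⟩ := hZinj
    rw [Finset.mem_coe] at hp hp'
    have hsub : ({p, p'} : Finset (ι × Fin 3)) ⊆ Z.filter fun x => x.1 = p.1 := by
      intro x hx
      rcases Finset.mem_insert.1 hx with rfl | hx
      · simp [hp]
      · rw [Finset.mem_singleton.1 hx]
        simp [hp', h1]
    -- `p` and `p'` are all the zeros of `Z` in their coset, so the cofactor keeps every remaining
    -- zero and `n` drops by the two zeros lost.
    have heq := Finset.eq_of_subset_of_card_le hsub (by rw [Finset.card_pair hne]; exact hZ2 p.1)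
    rcases Nat.lt_or_ge n 2 with hlt | hge
    · have hf1 : f ∈ gapPoly F (0 + 1) := fun d hd => by
        obtain ⟨i, hi, rfl⟩ := hf d hd
        exact ⟨i, by omega, rfl⟩
      have h0 := eq_C_of_natDegree_le_zero (natDegree_le_of_mem_gapPoly hf1)
      have h2 := hfZ p hp
      rw [h0, eval_C] at h2
      rw [h0, h2, C_0]
    obtain ⟨k, rfl⟩ := Nat.exists_eq_add_of_le' hge
    obtain ⟨g, hg, rfl⟩ := exists_eq_mul_of_two_roots hf (hinj.ne hne) ((hcube p p').2 h1)
      (hfZ p hp) (hfZ p' hp')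
    rw [ih k (by omega) (by omega) g hg (Z.filter fun x => x.1 ≠ p.1)
      (fun x hx => hZU x (Finset.mem_filter.1 hx).1) ?_ ?_ ?_, mul_zero]
    · have h2 := Finset.card_filter_add_card_filter_not (s := Z) (fun x => x.1 = p.1)
      have h3 := hZ2 p.1
      simp only [ne_eq]
      omega
    · exact fun i => (Finset.card_le_card
        (Finset.filter_subset_filter _ (Finset.filter_subset _ _))).trans (hZ2 i)
    · intro x hx
      obtain ⟨hxZ, hxp⟩ := Finset.mem_filter.1 hx
      have := hfZ x hxZ
      rw [eval_mul] at this
      refine (mul_eq_zero.1 this).resolve_left ?_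
      simp only [eval_sub, eval_pow, eval_X, eval_C]
      exact sub_ne_zero.2 fun h => hxp ((hcube x p).1 h)

end greedy

/-! ### Dimension and distance from counting zeros. -/

section MDS

variable {F : Type*} [Field F]

theorem restrictTo_range {ι M : Type*} [AddCommGroup M] [Module F M] (E : M →ₗ[F] (ι → F))
    (S : Finset ι) :
    restrictTo (LinearMap.range E) S =
      LinearMap.range ((LinearMap.funLeft F F (Subtype.val : S → ι)).comp E) :=
  (LinearMap.range_comp _ _).symm

theorem restrictTo_restrictTo_range {ι M : Type*} [AddCommGroup M] [Module F M]
    (E : M →ₗ[F] (ι → F)) (S : Finset ι) (S' : Finset S) :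
    restrictTo (restrictTo (LinearMap.range E) S) S' =
      LinearMap.range ((LinearMap.funLeft F F fun x : S' => x.1.1).comp E) := by
  rw [restrictTo_range, restrictTo_range]
  rfl

theorem hammingNorm_add_card_zeros {ι : Type*} [Fintype ι] [DecidableEq F] (c : ι → F) :
    hammingNorm c + (Finset.univ.filter fun i => c i = 0).card = Fintype.card ι := by
  rw [hammingNorm, add_comm, ← Finset.card_univ]
  exact Finset.card_filter_add_card_filter_not (s := Finset.univ) fun i => c i = 0

theorem injective_of_card_zeros_lt {ι M : Type*} [Fintype ι] [AddCommGroup M] [Module F M]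
    (E : M →ₗ[F] (ι → F)) {k : ℕ} (hk : k ≤ Fintype.card ι)
    (h : ∀ x ≠ 0, ∀ Z : Finset ι, (∀ i ∈ Z, E x i = 0) → Z.card < k) :
    Function.Injective E := by
  rw [← LinearMap.ker_eq_bot, LinearMap.ker_eq_bot']
  intro x hx
  by_contra hx0
  have := h x hx0 Finset.univ fun i _ => by rw [hx, Pi.zero_apply]
  rw [Finset.card_univ] at this
  omega

theorem isLinearCode_range {ι M : Type*} [Fintype ι] [AddCommGroup M] [Module F M]
    (E : M →ₗ[F] (ι → F)) {n k : ℕ} (hM : Module.finrank F M = k) (hn : Fintype.card ι = n)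
    (hk : k ≤ n) (h : ∀ x ≠ 0, ∀ Z : Finset ι, (∀ i ∈ Z, E x i = 0) → Z.card < k) :
    IsLinearCode n k (LinearMap.range E) :=
  ⟨hn, by rw [LinearMap.finrank_range_of_inj (injective_of_card_zeros_lt E (hn ▸ hk) h), hM]⟩

/-- A code of dimension `k` whose nonzero words have fewer than `k` zeros is MDS. -/
theorem isMDSCode_range {ι M : Type*} [Fintype ι] [AddCommGroup M] [Module F M]
    (E : M →ₗ[F] (ι → F)) {n k : ℕ} (hM : Module.finrank F M = k) (hn : Fintype.card ι = n)
    (hk0 : 0 < k) (hk : k ≤ n)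
    (h : ∀ x ≠ 0, ∀ Z : Finset ι, (∀ i ∈ Z, E x i = 0) → Z.card < k) :
    IsMDSCode n k (LinearMap.range E) := by
  classical
  refine ⟨isLinearCode_range E hM hn hk h, ?_⟩
  have hinj := injective_of_card_zeros_lt E (hn ▸ hk) h
  have hfin : Module.Finite F M := Module.finite_of_finrank_pos (hM ▸ hk0)
  obtain ⟨Z, -, hZ⟩ := Finset.exists_subset_card_eq (s := (Finset.univ : Finset ι))
    (n := k - 1) (by rw [Finset.card_univ]; omega)
  -- Only `k - 1` linear conditions on a `k`-dimensional space: a nonzero word with `k - 1` zeros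
  -- attains the Singleton bound.
  have hker : LinearMap.ker ((LinearMap.funLeft F F (Subtype.val : Z → ι)).comp E) ≠ ⊥ :=
    LinearMap.ker_ne_bot_of_finrank_lt (by
      rw [Module.finrank_fintype_fun_eq_card, Fintype.card_coe, hZ, hM]
      omega)
  obtain ⟨x, hx, hx0⟩ := Submodule.exists_mem_ne_zero_of_ne_bot hker
  have hxZ : ∀ i ∈ Z, E x i = 0 := fun i hi => congrFun (LinearMap.mem_ker.1 hx) ⟨i, hi⟩
  set D := {d | ∃ c ∈ LinearMap.range E, c ≠ 0 ∧ hammingNorm c = d} with hD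
  have hlow : ∀ d ∈ D, n + 1 - k ≤ d := by
    rintro _ ⟨_, ⟨y, rfl⟩, hy, rfl⟩
    have h1 := h y (fun h0 => hy (by rw [h0, map_zero])) (Finset.univ.filter fun i => E y i = 0)
      fun i hi => (Finset.mem_filter.1 hi).2
    have h2 := hammingNorm_add_card_zeros (E y)
    omega
  have hmem : hammingNorm (E x) ∈ D :=
    ⟨E x, ⟨x, rfl⟩, fun h0 => hx0 (hinj (by rw [h0, map_zero])), rfl⟩
  have hup : hammingNorm (E x) ≤ n + 1 - k := by
    have h1 : Z ⊆ Finset.univ.filter fun i => E x i = 0 := fun i hi =>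
      Finset.mem_filter.2 ⟨Finset.mem_univ _, hxZ i hi⟩
    have h2 := Finset.card_le_card h1
    have h3 := hammingNorm_add_card_zeros (E x)
    omega
  have hmin : minDist (LinearMap.range E) = n + 1 - k := by
    have : minDist (LinearMap.range E) = sInf D := by
      rw [minDist, hD]
    rw [this]
    exact le_antisymm ((Nat.sInf_le hmem).trans hup) (hlow _ (Nat.sInf_mem ⟨_, hmem⟩))
  omega

end MDS

/-! ### The encoding polynomials for `r = 2`. -/

section messagePoly

variable {F : Type*} [Field F]

theorem coeff_messagePoly (D : ℕ) (M : (Fin D → Fin 2 → F) × (Fin 1 → F)) (d : ℕ) :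
    (messagePoly 2 D 1 M).coeff d =
      (∑ j : Fin D, ∑ i : Fin 2, if d = j * 3 + i then M.1 j i else 0) +
        if d = D * 3 then M.2 0 else 0 := by
  simp [messagePoly, coeff_X_pow, -Fin.sum_univ_two]

theorem messagePoly_mem_gapPoly (D : ℕ) (M : (Fin D → Fin 2 → F) × (Fin 1 → F)) :
    messagePoly 2 D 1 M ∈ gapPoly F (2 * D + 1) := by
  rw [mem_gapPoly_iff]
  intro d hd
  by_contra h
  apply hd
  rw [coeff_messagePoly, if_neg (by omega), add_zero]
  refine Finset.sum_eq_zero fun j _ => Finset.sum_eq_zero fun i _ => if_neg ?_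
  have := j.2
  have := i.2
  omega

theorem messagePoly_eq_zero {D : ℕ} {M : (Fin D → Fin 2 → F) × (Fin 1 → F)}
    (h : messagePoly 2 D 1 M = 0) : M = 0 := by
  refine Prod.ext (funext fun j => funext fun i => ?_) (funext fun l => ?_)
  · have h1 := coeff_messagePoly D M (j * 3 + i)
    rw [h, coeff_zero, if_neg (by omega), add_zero, Finset.sum_eq_single j, Finset.sum_eq_single i,
      if_pos rfl] at h1
    · exact h1.symm
    · intro i' _ hi
      exact if_neg fun h => hi (Fin.ext (by omega))
    · simp
    · intro j' _ hj
      refine Finset.sum_eq_zero fun i' _ => if_neg fun h => hj (Fin.ext ?_)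
      have := i.2
      have := i'.2
      omega
    · simp
  · have h1 := coeff_messagePoly D M (D * 3)
    rw [h, coeff_zero, if_pos rfl, Finset.sum_eq_zero, zero_add] at h1
    · rw [Subsingleton.elim l 0]
      exact h1.symm
    · intro j _
      refine Finset.sum_eq_zero fun i _ => if_neg ?_
      have := j.2
      have := i.2
      omega

/-- Powers of `x ^ 3` are constant on a coset, so this form displays the restriction to a coset as a
polynomial linear in `x`. -/
theorem eval_messagePoly (D : ℕ) (M : (Fin D → Fin 2 → F) × (Fin 1 → F)) (x : F) :
    (messagePoly 2 D 1 M).eval x =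
      ((∑ j : Fin D, M.1 j 0 * (x ^ 3) ^ (j : ℕ)) + M.2 0 * (x ^ 3) ^ D) +
        (∑ j : Fin D, M.1 j 1 * (x ^ 3) ^ (j : ℕ)) * x := by
  have h : ∀ j : ℕ, x ^ (j * (2 + 1)) = (x ^ 3) ^ j := fun j => by rw [← pow_mul, mul_comm]
  have hs : ∑ j : Fin D, ∑ i : Fin 2, M.1 j i * x ^ ((j : ℕ) * (2 + 1) + (i : ℕ)) =
      (∑ j : Fin D, M.1 j 0 * (x ^ 3) ^ (j : ℕ)) +
        (∑ j : Fin D, M.1 j 1 * (x ^ 3) ^ (j : ℕ)) * x := by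
    rw [Finset.sum_mul, ← Finset.sum_add_distrib]
    refine Finset.sum_congr rfl fun j _ => ?_
    rw [Fin.sum_univ_two, pow_add, pow_add, h]
    simp [mul_assoc]
  simp only [messagePoly, eval_add, eval_finsetSum, eval_mul, eval_C, eval_pow, eval_X, hs,
    Finset.univ_unique, Finset.sum_singleton]
  rw [pow_add, h]
  simp
  ring

end messagePoly

/-! ### Evaluation points: distinctness, cubes and rotations. -/

section evalPoint

variable {F : Type*} [Field F] [Fintype F]

theorem orderOf_primitive {α : Fˣ} (hα : ∀ x : Fˣ, x ∈ Subgroup.zpowers α) :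
    orderOf α = Fintype.card F - 1 := by
  classical
  rw [orderOf_eq_card_of_forall_mem_zpowers hα, Nat.card_eq_fintype_card, Fintype.card_units]

theorem evalPoint_eq (α : Fˣ) (r m : ℕ) (p : Fin m × Fin (r + 1)) :
    evalPoint α r m p = ((α ^ ((p.1 : ℕ) + (Fintype.card F - 1) / (r + 1) * p.2) : Fˣ) : F) := by
  rw [evalPoint, ← pow_mul, ← pow_add]

theorem pow_card_sub_one_div_three (α : Fˣ) (h3 : 3 ∣ Fintype.card F - 1) :
    (α ^ ((Fintype.card F - 1) / 3)) ^ 3 = 1 := by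
  rw [← pow_mul, Nat.div_mul_cancel h3]
  exact Units.ext (by simpa using FiniteField.pow_card_sub_one_eq_one (α : F) α.ne_zero)

theorem evalPoint_injective {α : Fˣ} (hα : ∀ x : Fˣ, x ∈ Subgroup.zpowers α)
    (h3 : 3 ∣ Fintype.card F - 1) :
    Function.Injective (evalPoint α 2 ((Fintype.card F - 1) / 3)) := by
  rintro ⟨i, l⟩ ⟨i', l'⟩ h
  rw [evalPoint_eq, evalPoint_eq] at h
  have hi := i.2
  have hi' := i'.2
  have ho := orderOf_primitive hα
  obtain ⟨M, hM⟩ := h3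
  have hM3 : (Fintype.card F - 1) / 3 = M := by omega
  have hb : ∀ (a : Fin ((Fintype.card F - 1) / 3)) (k : Fin 3),
      (a : ℕ) + (Fintype.card F - 1) / (2 + 1) * k < orderOf α := by
    intro a k
    have ha := a.2
    rw [ho]
    fin_cases k <;> simp <;> omega
  have h2 := pow_injOn_Iio_orderOf (x := α)
    (hb i l)
    (hb i' l') (Units.ext h)
  simp only [Nat.reduceAdd, hM3] at h2
  have hl : l = l' := by
    fin_cases l <;> fin_cases l' <;> first | rfl | (exfalso; simp at h2; omega)
  subst hl
  exact Prod.ext (Fin.ext (by simpa using h2)) rfl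

theorem evalPoint_pow_three (α : Fˣ) (h3 : 3 ∣ Fintype.card F - 1) {m : ℕ} (p : Fin m × Fin 3) :
    evalPoint α 2 m p ^ 3 = ((α ^ (3 * (p.1 : ℕ)) : Fˣ) : F) := by
  rw [evalPoint, ← Units.val_pow_eq_pow_val, mul_pow, pow_right_comm, pow_right_comm _ _ 3,
    pow_card_sub_one_div_three α h3, one_pow, mul_one, ← pow_mul]

theorem evalPoint_pow_three_eq_iff {α : Fˣ} (hα : ∀ x : Fˣ, x ∈ Subgroup.zpowers α)
    (h3 : 3 ∣ Fintype.card F - 1) (p p' : Fin ((Fintype.card F - 1) / 3) × Fin 3) :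
    evalPoint α 2 _ p ^ 3 = evalPoint α 2 _ p' ^ 3 ↔ p.1 = p'.1 := by
  rw [evalPoint_pow_three α h3, evalPoint_pow_three α h3]
  refine ⟨fun h => ?_, fun h => by rw [h]⟩
  have hp := p.1.2
  have hp' := p'.1.2
  have ho := orderOf_primitive hα
  have h2 := pow_injOn_Iio_orderOf (x := α) (by rw [Set.mem_Iio, ho]; omega)
    (by rw [Set.mem_Iio, ho]; omega) (Units.ext h)
  exact Fin.ext (Nat.eq_of_mul_eq_mul_left three_pos h2)

theorem pow_fin_add {G : Type*} [Monoid G] {b : G} (hb : b ^ 3 = 1) (k t : Fin 3) :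
    b ^ ((k + t : Fin 3) : ℕ) = b ^ (k : ℕ) * b ^ (t : ℕ) := by
  rw [Fin.val_add, ← pow_add]
  conv_rhs => rw [← Nat.mod_add_div ((k : ℕ) + t) 3, pow_add, pow_mul, hb, one_pow, mul_one]

theorem evalPoint_hasRotations (α : Fˣ) (h3 : 3 ∣ Fintype.card F - 1) (m : ℕ) :
    HasRotations (ι := Fin m) (evalPoint α 2 m) := by
  intro l l'
  have hb := pow_card_sub_one_div_three α h3
  set β := α ^ ((Fintype.card F - 1) / 3) with hβ
  refine ⟨((β ^ ((l - l' : Fin 3) : ℕ) : Fˣ) : F), Units.ne_zero _, fun k => k + (l' - l),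
    add_sub_cancel l l', fun i k => ?_⟩
  rw [evalPoint, evalPoint, ← Units.val_mul]
  congr 1
  change α ^ (i : ℕ) * β ^ (k : ℕ) = _ * (α ^ (i : ℕ) * β ^ ((k + (l' - l) : Fin 3) : ℕ))
  rw [mul_left_comm, ← pow_fin_add hb]
  congr 3
  abel

end evalPoint

/-! ### Maximally recoverable puncturings above the threshold. -/

section existence

/-- Links the threshold to the greedy count, which needs only the weight `j / 2`; this suffices
because `gWeight` is at least `1 / 2`. -/
theorem threshold_lower_bound (m D : ℕ) :
    (∑ j ∈ Finset.Icc 2 (2 * D), (((j / 2) * (m - 1).choose j * 3 ^ j : ℕ) : ℤ)) + 3 * m - 2 ≤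
      fieldSizeThreshold (3 * m) D := by
  rw [fieldSizeThreshold, Nat.mul_div_cancel_left _ (by norm_num)]
  have h : ∑ j ∈ Finset.Icc 2 (2 * D), (((j / 2) * (m - 1).choose j * 3 ^ j : ℕ) : ℤ) ≤
      ∑ j ∈ Finset.Icc 2 (2 * D), ⌊(j : ℚ) * gWeight D j⌋ * ((m - 1).choose j : ℤ) * 3 ^ j := by
    refine Finset.sum_le_sum fun j _ => ?_
    push_cast
    gcongr
    rw [Int.le_floor]
    have h1 : (1 / 2 : ℚ) ≤ gWeight D j := by
      unfold gWeight
      split_ifs <;> norm_num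
    have h2 : ((j / 2 : ℕ) : ℚ) ≤ j / 2 := Nat.cast_div_le
    have h3 : (j : ℚ) * (1 / 2) ≤ j * gWeight D j := by gcongr
    refine le_trans ?_ h3
    rw [mul_one_div]
    exact_mod_cast h2
  have h0 : (0 : ℤ) ≤
      ∑ j ∈ Finset.Icc 2 (2 * D), (((j / 2) * (m - 1).choose j * 3 ^ j : ℕ) : ℤ) :=
    Finset.sum_nonneg fun j _ => Int.natCast_nonneg _
  push_cast at h h0 ⊢
  linarith

variable {F : Type*} [Field F] [Fintype F]

theorem exists_isGeneric_evalPoint {α : Fˣ} (hα : ∀ x : Fˣ, x ∈ Subgroup.zpowers α)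
    (h3 : 3 ∣ Fintype.card F - 1) {m D : ℕ} (hm : 0 < m)
    (hq : fieldSizeThreshold (3 * m) D < (Fintype.card F : ℤ)) :
    ∃ U : Finset (Fin ((Fintype.card F - 1) / 3)), U.card = m ∧
      IsGeneric (evalPoint α 2 _) (2 * D + 1) U := by
  refine exists_isGeneric (evalPoint_injective hα h3) (evalPoint_hasRotations α h3 _) (m := m) ?_
    m le_rfl
  have h := (threshold_lower_bound m D).trans_lt hq
  have hF := Fintype.one_lt_card (α := F)
  rw [Fintype.card_fin, Nat.mul_div_cancel' h3]
  rw [← Nat.cast_sum] at h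
  omega

theorem card_zeros_lt {α : Fˣ} (hα : ∀ x : Fˣ, x ∈ Subgroup.zpowers α)
    (h3 : 3 ∣ Fintype.card F - 1) {D : ℕ} {U : Finset (Fin ((Fintype.card F - 1) / 3))}
    (hU : IsGeneric (evalPoint α 2 _) (2 * D + 1) U)
    {x : (Fin D → Fin 2 → F) × (Fin 1 → F)} (hx : x ≠ 0)
    (Z : Finset (Fin ((Fintype.card F - 1) / 3) × Fin 3)) (hZU : ∀ p ∈ Z, p.1 ∈ U)
    (hZ2 : ∀ i, (Z.filter fun p => p.1 = i).card ≤ 2)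
    (hxZ : ∀ p ∈ Z, tamoBargEncoder α 2 _ D 1 x p = 0) : Z.card < 2 * D + 1 := by
  by_contra! h
  exact hx (messagePoly_eq_zero (hU.eq_zero (evalPoint_injective hα h3)
    (evalPoint_pow_three_eq_iff hα h3) _ le_rfl _ (messagePoly_mem_gapPoly D x) Z hZU h hZ2 hxZ))

theorem finrank_message {F : Type*} [Field F] (D : ℕ) :
    Module.finrank F ((Fin D → Fin 2 → F) × (Fin 1 → F)) = 2 * D + 1 := by
  rw [Module.finrank_prod, Module.finrank_pi_fintype]
  simp [mul_comm]

/-- The values of the code on a coset are the values of all linear polynomials. -/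
theorem isMDSCode_coset {α : Fˣ} (hα : ∀ x : Fˣ, x ∈ Subgroup.zpowers α)
    (h3 : 3 ∣ Fintype.card F - 1) {D : ℕ} (hD : 0 < D) {κ : Type*} [Fintype κ]
    (hκ : Fintype.card κ = 2 + 1) (v : κ → Fin ((Fintype.card F - 1) / 3) × Fin (2 + 1))
    (hv : Function.Injective v) {i : Fin ((Fintype.card F - 1) / 3)} (hi : ∀ x, (v x).1 = i) :
    IsMDSCode (2 + 1) 2
      (LinearMap.range ((LinearMap.funLeft F F v).comp (tamoBargEncoder α 2 _ D 1))) := by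
  set ev := evalPoint α 2 ((Fintype.card F - 1) / 3) with hev
  let R : F × F →ₗ[F] (κ → F) :=
    { toFun := fun a x => a.1 + a.2 * ev (v x)
      map_add' := fun a b => by ext x; simp; ring
      map_smul' := fun c a => by ext x; simp; ring }
  have hcube : ∀ x, ev (v x) ^ 3 = ev (i, 0) ^ 3 := fun x =>
    (evalPoint_pow_three_eq_iff hα h3 _ _).2 (hi x)
  have henc : ∀ M x, (LinearMap.funLeft F F v).comp (tamoBargEncoder α 2 _ D 1) M x =
      (messagePoly 2 D 1 M).eval (ev (v x)) := fun _ _ => rfl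
  have hR : LinearMap.range ((LinearMap.funLeft F F v).comp (tamoBargEncoder α 2 _ D 1)) =
      LinearMap.range R := by
    apply le_antisymm
    · rintro _ ⟨M, rfl⟩
      refine ⟨((∑ j : Fin D, M.1 j 0 * (ev (i, 0) ^ 3) ^ (j : ℕ)) +
        M.2 0 * (ev (i, 0) ^ 3) ^ D, ∑ j : Fin D, M.1 j 1 * (ev (i, 0) ^ 3) ^ (j : ℕ)), ?_⟩
      funext x
      rw [henc, eval_messagePoly, hcube x]
      rfl
    · rintro _ ⟨a, rfl⟩
      -- The block `j = 0`, present because `0 < D`, already realises every linear polynomial.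
      refine ⟨(fun j => if (j : ℕ) = 0 then ![a.1, a.2] else 0, 0), ?_⟩
      funext x
      rw [henc, eval_messagePoly]
      have hs : ∀ l : Fin 2, ∑ j : Fin D,
          (if (j : ℕ) = 0 then ![a.1, a.2] else 0) l * (ev (v x) ^ 3) ^ (j : ℕ) =
          ![a.1, a.2] l := by
        intro l
        rw [Finset.sum_eq_single ⟨0, hD⟩]
        · simp
        · intro j _ hj
          rw [if_neg fun h => hj (Fin.ext h)]
          simp
        · simp
      rw [hs, hs]
      simp [R]
  rw [hR]
  refine isMDSCode_range R (by simp) hκ (by norm_num) (by norm_num) fun a ha Z hZ => ?_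
  by_contra! h
  obtain ⟨x, hx, y, hy, hxy⟩ := Finset.one_lt_card.1 h
  have e1 : a.1 + a.2 * ev (v x) = 0 := hZ x hx
  have e2 : a.1 + a.2 * ev (v y) = 0 := hZ y hy
  have hne : ev (v x) - ev (v y) ≠ 0 :=
    sub_ne_zero.2 fun h => hxy (hv (evalPoint_injective hα h3 h))
  have h2 : a.2 = 0 := by
    have : a.2 * (ev (v x) - ev (v y)) = 0 := by linear_combination e1 - e2
    exact (mul_eq_zero.1 this).resolve_right hne
  exact ha (Prod.ext (by simpa [h2] using e1) h2)

theorem hasMRPuncturing_of_threshold {m D : ℕ} (hD : 0 < D) (hDm : D < m)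
    (h3 : 3 ∣ Fintype.card F - 1)
    (hq : fieldSizeThreshold (3 * m) D < (Fintype.card F : ℤ)) :
    HasMRPuncturing F (3 * m) D := by
  intro α hα
  obtain ⟨U, hUm, hU⟩ := exists_isGeneric_evalPoint hα h3 (by omega) hq
  have hm3 : 3 * m / 3 = m := Nat.mul_div_cancel_left _ (by norm_num)
  set T := Uᶜ with hT
  have hmem : ∀ {p : Fin ((Fintype.card F - 1) / 3) × Fin (2 + 1)},
      p ∈ ({p | p.1 ∉ T} : Finset _) ↔ p.1 ∈ U := by
    intro p
    simp [hT]
  let φ : U ≃ Fin m := U.equivFinOfCardEq hUm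
  let e : ({p | p.1 ∉ T} : Finset (Fin ((Fintype.card F - 1) / 3) × Fin (2 + 1))) ≃
      Fin m × Fin (2 + 1) :=
    { toFun := fun p => (φ ⟨p.1.1, hmem.1 p.2⟩, p.1.2)
      invFun := fun a => ⟨((φ.symm a.1).1, a.2), hmem.2 (φ.symm a.1).2⟩
      left_inv := fun p => by simp
      right_inv := fun a => by simp }
  have he1 : ∀ x y, (e x).1 = (e y).1 ↔ x.1.1 = y.1.1 := by
    intro x y
    simp [e]
  have hcode : puncturedTamoBarg α D T = _ := restrictTo_range (tamoBargEncoder α 2 _ D 1) _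
  have hlin : IsLinearCode (3 * m) (2 * D + 1) (puncturedTamoBarg α D T) := by
    refine ⟨by rw [Fintype.card_congr e]; simp [mul_comm], ?_⟩
    rw [hcode, LinearMap.finrank_range_of_inj, finrank_message]
    rw [← LinearMap.ker_eq_bot, LinearMap.ker_eq_bot']
    intro x hx
    by_contra hx0
    -- A word vanishing everywhere vanishes at two points of each chosen coset, which is `2 * m ≥ 2
    -- * D + 1` zeros.
    have := card_zeros_lt hα h3 hU hx0 (U ×ˢ {1, 2}) (fun p hp => (Finset.mem_product.1 hp).1)
      (fun i => ?_) fun p hp =>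
        congrFun hx ⟨p, hmem.2 (Finset.mem_product.1 hp).1⟩
    · rw [Finset.card_product, hUm, Finset.card_pair (by decide)] at this
      omega
    · refine (Finset.card_le_card_of_injOn Prod.snd (t := {1, 2}) ?_ ?_).trans_eq
        (Finset.card_pair (by decide))
      · intro p hp
        exact (Finset.mem_product.1 (Finset.mem_filter.1 hp).1).2
      · intro p hp p' hp' h
        exact Prod.ext ((Finset.mem_filter.1 hp).2.trans (Finset.mem_filter.1 hp').2.symm) h
  refine ⟨T, ?_, hlin, m, 2 * D + 1, by omega, by rwa [mul_comm], e, ?_, ?_⟩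
  · rw [hm3, ← hUm, hT, Finset.card_compl_add_card, Fintype.card_fin]
  · intro a
    rw [puncturedTamoBarg, tamoBargCode, restrictTo_restrictTo_range]
    have hinj : Function.Injective fun y : {x // x ∈ ({x | (e x).1 = a} : Finset _)} =>
        y.1.1 := Subtype.val_injective.comp Subtype.val_injective
    refine isMDSCode_coset hα h3 hD ?_ _ hinj (i := (φ.symm a).1) ?_
    · have : ({x | (e x).1 = a} : Finset _) =
          (({a} : Finset (Fin m)) ×ˢ (Finset.univ : Finset (Fin (2 + 1)))).map
            e.symm.toEmbedding := by
        ext x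
        rw [Finset.mem_map_equiv, Finset.mem_product]
        simp
      rw [Fintype.card_coe, this, Finset.card_map]
      simp
    · rintro ⟨x, hx⟩
      have : (e x).1 = a := by simpa using hx
      simp [← this, e]
  · intro P hP
    rw [puncturedTamoBarg, tamoBargCode, restrictTo_restrictTo_range]
    refine isMDSCode_range _ (finrank_message D) ?_ (by omega) (by omega) ?_
    · have : ({x | (e x).2 ∉ P (e x).1} : Finset _) =
          (Finset.univ.filter fun y : Fin m × Fin (2 + 1) => y.2 ∉ P y.1).map
            e.symm.toEmbedding := by
        ext x
        simp [Finset.mem_map_equiv]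
      rw [Fintype.card_coe, this, Finset.card_map, Finset.card_filter, Fintype.sum_prod_type]
      have hrow : ∀ a, (∑ l : Fin (2 + 1), if l ∉ P a then 1 else 0) = 2 := by
        intro a
        have h : (Finset.univ.filter fun l => l ∉ P a) = (P a)ᶜ := by
          ext l
          simp
        rw [← Finset.card_filter, h, Finset.card_compl, hP]
        rfl
      rw [Finset.sum_congr rfl fun a _ => hrow a]
      simp
    · intro x hx Z hZ
      have hinj : Function.Injective fun y : {x // x ∈ ({x | (e x).2 ∉ P (e x).1} : Finset _)} =>
          y.1.1 := Subtype.val_injective.comp Subtype.val_injective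
      rw [← Finset.card_map ⟨_, hinj⟩]
      refine card_zeros_lt hα h3 hU hx _ ?_ ?_ ?_
      · intro p hp
        obtain ⟨y, -, rfl⟩ := Finset.mem_map.1 hp
        exact hmem.1 y.1.2
      · intro i
        rcases Finset.eq_empty_or_nonempty ((Z.map ⟨_, hinj⟩).filter fun p => p.1 = i) with h | h
        · rw [h]
          simp
        obtain ⟨p₀, hp₀⟩ := h
        obtain ⟨hp₀, hi⟩ := Finset.mem_filter.1 hp₀
        obtain ⟨y₀, -, rfl⟩ := Finset.mem_map.1 hp₀
        -- Zeros in one coset sit in distinct unpunctured positions of its row, and there are two of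
        -- these.
        refine (Finset.card_le_card_of_injOn Prod.snd (t := (P (e y₀.1).1)ᶜ) ?_ ?_).trans_eq ?_
        · intro p hp
          obtain ⟨hp, hpi⟩ := Finset.mem_filter.1 hp
          obtain ⟨y, -, rfl⟩ := Finset.mem_map.1 hp
          have h1 : (e y.1).1 = (e y₀.1).1 := (he1 _ _).2 (hpi.trans hi.symm)
          have h2 : (e y.1).2 ∉ P (e y.1).1 := by simpa using y.2
          rw [h1] at h2
          exact Finset.mem_coe.2 (Finset.mem_compl.2 h2)
        · intro p hp p' hp' h
          exact Prod.ext ((Finset.mem_filter.1 hp).2.trans (Finset.mem_filter.1 hp').2.symm) h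
        · rw [Finset.card_compl, hP]
          rfl
      · intro p hp
        obtain ⟨y, hy, rfl⟩ := Finset.mem_map.1 hp
        exact hZ y hy

end existence

/-! ### Exponential growth of the threshold. -/

section growth

theorem cosetGrowth_eq_exp {γ : ℝ} (h0 : 0 < γ) (h1 : γ < 1) :
    cosetGrowth γ = Real.exp (γ * Real.log 3 - γ * Real.log γ - (1 - γ) * Real.log (1 - γ)) := by
  rw [cosetGrowth, Real.rpow_def_of_pos (by norm_num), Real.rpow_def_of_pos h0,
    Real.rpow_def_of_pos (by linarith), ← Real.exp_add, ← Real.exp_sub]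
  congr 1
  ring

/-- The derivative `log 3 - log x + log (1 - x)` is positive exactly when `x < 3 * (1 - x)`, which
is where `3 / 4` comes from. -/
theorem strictMonoOn_cosetGrowth_exponent :
    StrictMonoOn (fun γ : ℝ => γ * Real.log 3 - γ * Real.log γ - (1 - γ) * Real.log (1 - γ))
      (Set.Ioc 0 (3 / 4)) := by
  have hd : ∀ x ∈ Set.Ioc (0 : ℝ) (3 / 4), HasDerivAt
      (fun γ : ℝ => γ * Real.log 3 - γ * Real.log γ - (1 - γ) * Real.log (1 - γ))
      (Real.log 3 - Real.log x + Real.log (1 - x)) x := by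
    intro x hx
    have hx0 := hx.1
    have hx1 : 1 - x ≠ 0 := by linarith [hx.2]
    have a1 := (hasDerivAt_id x).mul_const (Real.log 3)
    have a2 := Real.hasDerivAt_mul_log hx0.ne'
    have a3 := (Real.hasDerivAt_mul_log hx1).comp x ((hasDerivAt_id x).const_sub 1)
    exact ((a1.sub a2).sub a3).congr_deriv (by ring)
  refine strictMonoOn_of_deriv_pos (convex_Ioc _ _)
    (fun x hx => (hd x hx).continuousAt.continuousWithinAt) fun x hx => ?_
  rw [interior_Ioc] at hx
  rw [(hd x ⟨hx.1, hx.2.le⟩).deriv]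
  have := Real.log_lt_log hx.1 (show x < 3 * (1 - x) by linarith [hx.2])
  rw [Real.log_mul (by norm_num) (by linarith [hx.2])] at this
  linarith

theorem growthE1_eq {y : ℝ} (h1 : 5 / 4 ≤ y) (h2 : y < 2) : growthE1 y = cosetGrowth (2 - y) := by
  obtain ⟨⟨γ, hγ, hγe⟩, hmax⟩ := growthE1_isGreatest (by linarith) h2
  refine le_antisymm ?_ (hmax ⟨2 - y, ⟨by linarith, le_rfl⟩, rfl⟩)
  rw [← hγe, cosetGrowth_eq_exp hγ.1 (by linarith [hγ.2]),
    cosetGrowth_eq_exp (by linarith) (by linarith), Real.exp_le_exp]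
  exact strictMonoOn_cosetGrowth_exponent.monotoneOn ⟨hγ.1, by linarith [hγ.2]⟩
    ⟨by linarith, by linarith⟩ hγ.2

theorem cosetGrowth_three_quarters : cosetGrowth (3 / 4) = 4 := by
  rw [cosetGrowth_eq_exp (by norm_num) (by norm_num), show (1 - 3 / 4 : ℝ) = 4⁻¹ by norm_num,
    Real.log_div (by norm_num) (by norm_num), Real.log_inv]
  ring_nf
  exact Real.exp_log (by norm_num)

theorem growthE1_lt_four {y : ℝ} (h1 : 1.3 ≤ y) (h2 : y < 2) : growthE1 y < 4 := by
  norm_num at h1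
  rw [growthE1_eq (by linarith) h2, ← cosetGrowth_three_quarters,
    cosetGrowth_eq_exp (by linarith) (by linarith), cosetGrowth_eq_exp (by linarith) (by linarith),
    Real.exp_lt_exp]
  exact strictMonoOn_cosetGrowth_exponent ⟨by linarith, by linarith⟩ ⟨by linarith, by linarith⟩
    (by linarith)

theorem growthE1_lt_growthE2 {y : ℝ} (h1 : 5 / 4 ≤ y) (h2 : y < 2) : growthE1 y < growthE2 y := by
  rw [growthE1_eq h1 h2, cosetGrowth_eq_exp (by linarith) (by linarith), growthE2,
    Real.rpow_def_of_pos (by linarith), Real.rpow_def_of_pos (by linarith), ← Real.exp_add,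
    show (27 : ℝ) = Real.exp (3 * Real.log 3) by
      rw [mul_comm, ← Real.rpow_def_of_pos (by norm_num)]; norm_num,
    ← Real.exp_sub, Real.exp_lt_exp]
  -- After taking logarithms the claim is strict Jensen for `x log x` at `1` and `y - 1` with
  -- weights `2 / 3` and `1 / 3`, whose mean is `(1 + y) / 3`.
  have hj := Real.strictConvexOn_mul_log.2 (show (1 : ℝ) ∈ Set.Ici 0 by simp)
    (show y - 1 ∈ Set.Ici 0 by simp; linarith) (by linarith) (show (0 : ℝ) < 2 / 3 by norm_num)
    (show (0 : ℝ) < 1 / 3 by norm_num) (by norm_num)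
  simp only [smul_eq_mul, Real.log_one] at hj
  rw [show (2 / 3 * 1 + 1 / 3 * (y - 1) : ℝ) = (1 + y) / 3 by ring,
    Real.log_div (by linarith) (by norm_num)] at hj
  rw [show 1 - (2 - y) = y - 1 by ring]
  linarith

/-- A single term of the binomial distribution with success probability `γ = j / m` is at most 1. -/
theorem choose_mul_three_pow_le {m j : ℕ} (hj : 0 < j) (hjm : j < m) :
    (m.choose j : ℝ) * 3 ^ j ≤ cosetGrowth ((j : ℝ) / m) ^ m := by
  have hm : (0 : ℝ) < m := by exact_mod_cast hj.trans hjm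
  have hj' : (0 : ℝ) < j := by exact_mod_cast hj
  set γ := (j : ℝ) / m with hγ
  have h0 : 0 < γ := by positivity
  have h1 : 0 < 1 - γ := by
    rw [sub_pos, hγ, div_lt_one hm]
    exact_mod_cast hjm
  have hpow : ∀ x : ℝ, 0 < x → (x ^ γ) ^ m = x ^ j := by
    intro x hx
    rw [← Real.rpow_natCast, ← Real.rpow_mul hx.le, hγ, div_mul_cancel₀ _ hm.ne',
      Real.rpow_natCast]
  have hpow' : ((1 - γ) ^ (1 - γ)) ^ m = (1 - γ) ^ (m - j) := by
    rw [← Real.rpow_natCast, ← Real.rpow_mul h1.le, sub_mul, hγ, div_mul_cancel₀ _ hm.ne', one_mul,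
      ← Nat.cast_sub hjm.le, Real.rpow_natCast]
  rw [cosetGrowth, div_pow, mul_pow, hpow 3 (by norm_num), hpow γ h0, hpow', le_div_iff₀
    (by positivity)]
  have hb := add_pow γ (1 - γ) m
  rw [add_sub_cancel, one_pow] at hb
  have hs := Finset.single_le_sum (f := fun i => γ ^ i * (1 - γ) ^ (m - i) * (m.choose i : ℝ))
    (fun i _ => by positivity) (Finset.mem_range.2 (hjm.trans (Nat.lt_succ_self m)))
  rw [← hb] at hs
  calc _ = 3 ^ j * (γ ^ j * (1 - γ) ^ (m - j) * (m.choose j : ℝ)) := by ring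
    _ ≤ 3 ^ j * 1 := by gcongr
    _ = _ := mul_one _

theorem floor_weight_le (D j : ℕ) : ⌊(j : ℚ) * gWeight D j⌋ ≤ (j : ℤ) := by
  have h1 : gWeight D j ≤ 1 := by
    unfold gWeight
    split_ifs <;> norm_num
  have h2 : (j : ℚ) * gWeight D j ≤ ((j : ℤ) : ℚ) := by
    push_cast
    exact mul_le_of_le_one_right (by positivity) h1
  exact (Int.floor_le_floor h2).trans_eq (Int.floor_intCast _)

theorem threshold_le (m D : ℕ) :
    (fieldSizeThreshold (3 * m) D : ℝ) ≤
      2 * (∑ j ∈ Finset.Icc 2 (2 * D), (j : ℝ) * ((m - 1).choose j : ℝ) * 3 ^ j) + 3 * m - 2 := by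
  have h : fieldSizeThreshold (3 * m) D ≤
      2 * (∑ j ∈ Finset.Icc 2 (2 * D), (j : ℤ) * ((m - 1).choose j : ℤ) * 3 ^ j)
        + 3 * (m : ℤ) - 2 := by
    rw [fieldSizeThreshold, Nat.mul_div_cancel_left _ (by norm_num)]
    push_cast
    gcongr with j hj
    exact floor_weight_le D j
  exact_mod_cast h

theorem threshold_le_four_pow {m : ℕ} (hm : 2 ≤ m) (D : ℕ) :
    (fieldSizeThreshold (3 * m) D : ℝ) ≤ 6 * (((m : ℝ) - 1) * 4 ^ (m - 1)) := by
  obtain ⟨n, rfl⟩ := Nat.exists_eq_add_of_le' (show 1 ≤ m by omega)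
  refine (threshold_le _ _).trans ?_
  have hn : (1 : ℝ) ≤ n := by exact_mod_cast (by omega : 1 ≤ n)
  rw [Nat.add_sub_cancel]
  push_cast
  rw [add_sub_cancel_right]
  have h1 : ∑ j ∈ Finset.Icc 2 (2 * D), (j : ℝ) * (n.choose j : ℝ) * 3 ^ j ≤
      n * ∑ j ∈ Finset.range (n + 1), (n.choose j : ℝ) * 3 ^ j := by
    rw [Finset.mul_sum]
    -- Terms with `j > n` vanish with their binomial coefficient, so `2 * D` may exceed `n`.
    rw [← Finset.sum_filter_of_ne (p := fun j => j ∈ Finset.range (n + 1)) fun j _ hj => ?_]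
    · refine (Finset.sum_le_sum_of_subset_of_nonneg (t := Finset.range (n + 1))
        (fun j hj => (Finset.mem_filter.1 hj).2) fun j _ _ => by positivity).trans
        (Finset.sum_le_sum fun j hj => ?_)
      rw [mul_assoc]
      gcongr
      exact Nat.lt_succ_iff.1 (Finset.mem_range.1 hj)
    · rw [Finset.mem_range]
      by_contra h
      exact hj (by rw [Nat.choose_eq_zero_of_lt (by omega)]; simp)
  have h2 : ∑ j ∈ Finset.range (n + 1), (n.choose j : ℝ) * 3 ^ j = 4 ^ n := by
    have := add_pow (3 : ℝ) 1 n
    norm_num at this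
    rw [this]
    exact Finset.sum_congr rfl fun j _ => mul_comm _ _
  rw [h2] at h1
  have h4 : (4 : ℝ) ≤ 4 ^ n := le_self_pow₀ (by norm_num) (by omega)
  nlinarith

theorem threshold_le_growth {m D : ℕ} (hD : 0 < D) {y : ℝ} (hy1 : 1 < y) (hy2 : y < 2)
    (h : (2 * D : ℝ) = (2 - y) * m) :
    (fieldSizeThreshold (3 * m) D : ℝ) ≤ 3 * ((m : ℝ) ^ 2 * growthE1 y ^ m) := by
  have hD' : (1 : ℝ) ≤ D := by exact_mod_cast hD
  have hm0 : (0 : ℝ) < m := by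
    by_contra! h0
    nlinarith
  have hDm : 2 * D < m := by
    have : (2 * D : ℝ) < m := by nlinarith
    exact_mod_cast this
  have hterm : ∀ j, 0 < j → j ≤ 2 * D → (m.choose j : ℝ) * 3 ^ j ≤ growthE1 y ^ m := by
    intro j hj0 hj
    refine (choose_mul_three_pow_le hj0 (by omega)).trans ?_
    have hj' : (0 : ℝ) < j := by exact_mod_cast hj0
    have hγ0 : 0 < (j : ℝ) / m := by positivity
    have hγ1 : (j : ℝ) / m ≤ 2 - y := by
      rw [div_le_iff₀ hm0, ← h]
      exact_mod_cast hj
    have hγ : (j : ℝ) / m < 1 := by linarith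
    refine pow_le_pow_left₀ ?_ ((growthE1_isGreatest hy1.le hy2).2 ⟨_, ⟨hγ0, hγ1⟩, rfl⟩) m
    rw [cosetGrowth_eq_exp hγ0 hγ]
    exact (Real.exp_pos _).le
  have hsum : ∑ j ∈ Finset.Icc 2 (2 * D), (j : ℝ) * ((m - 1).choose j : ℝ) * 3 ^ j ≤
      m * (m * growthE1 y ^ m) := by
    have hg : 0 ≤ growthE1 y ^ m := le_trans (by positivity) (hterm 1 one_pos (by omega))
    calc _ ≤ ∑ j ∈ Finset.Icc 2 (2 * D), (m : ℝ) * growthE1 y ^ m := by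
          refine Finset.sum_le_sum fun j hj => ?_
          obtain ⟨hj2, hjD⟩ := Finset.mem_Icc.1 hj
          rw [mul_assoc]
          gcongr
          · exact_mod_cast (by omega : j ≤ m)
          · refine le_trans ?_ (hterm j (by omega) hjD)
            gcongr
            omega
      _ ≤ _ := by
          rw [Finset.sum_const, nsmul_eq_mul, Nat.card_Icc]
          gcongr
          exact_mod_cast (by omega : 2 * D + 1 - 2 ≤ m)
  -- The term `j = 1` absorbs the linear part `3 * m` of the threshold.
  have hone : (m : ℝ) * 3 ≤ growthE1 y ^ m := by simpa using hterm 1 one_pos (by omega)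
  have hm1 : (1 : ℝ) ≤ m := by exact_mod_cast (by omega : 1 ≤ m)
  have := threshold_le m D
  nlinarith [mul_le_mul hm1 hm1 zero_le_one hm0.le]

end growth

/-! ### A suitable prime power just above the threshold. -/

section fieldSize

theorem exists_four_pow_between {x : ℝ} (hx : 1 ≤ x) :
    ∃ t : ℕ, t ≠ 0 ∧ x < 4 ^ t ∧ (4 : ℝ) ^ t ≤ 4 * x := by
  obtain ⟨n, h1, h2⟩ := exists_nat_pow_near hx (by norm_num : (1 : ℝ) < 4)
  exact ⟨n + 1, n.succ_ne_zero, h2, by rw [pow_succ]; linarith⟩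

theorem one_le_fieldSizeThreshold {m : ℕ} (hm : 0 < m) (D : ℕ) :
    1 ≤ fieldSizeThreshold (3 * m) D := by
  have h := threshold_lower_bound m D
  have h0 : (0 : ℤ) ≤
      ∑ j ∈ Finset.Icc 2 (2 * D), (((j / 2) * (m - 1).choose j * 3 ^ j : ℕ) : ℤ) :=
    Finset.sum_nonneg fun j _ => Int.natCast_nonneg _
  omega

/-- Powers of 4 are prime powers congruent to 1 mod 3, and one lies within a factor 4 above any real
number that is at least 1. -/
theorem exists_primePow_above_threshold {m : ℕ} (hm : 0 < m) (D : ℕ) :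
    ∃ q : ℕ, IsPrimePow q ∧ 3 ∣ q - 1 ∧ fieldSizeThreshold (3 * m) D < (q : ℤ) ∧
      (q : ℝ) ≤ 4 * (fieldSizeThreshold (3 * m) D : ℝ) := by
  obtain ⟨t, ht, h1, h2⟩ := exists_four_pow_between
    (x := (fieldSizeThreshold (3 * m) D : ℝ)) (by exact_mod_cast one_le_fieldSizeThreshold hm D)
  refine ⟨4 ^ t, ?_, ?_, by exact_mod_cast h1, by exact_mod_cast h2⟩
  · rw [show 4 = 2 ^ 2 by norm_num, ← pow_mul]
    exact Nat.prime_two.isPrimePow.pow (by omega)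
  · simpa using Nat.sub_dvd_pow_sub_pow 4 1 t

end fieldSize

/-! ### The repetition code, `D = 0`. -/

section repetition

variable {F : Type*} [Field F] [Fintype F]

/-- For `D = 0` the punctured code consists of the constant words. -/
theorem tamoBargCode_zero (α : Fˣ) (m : ℕ) :
    tamoBargCode α 2 m 0 1 =
      LinearMap.range (LinearMap.toSpanSingleton F _ (1 : Fin m × Fin 3 → F)) := by
  ext c
  constructor
  · rintro ⟨M, rfl⟩
    refine ⟨M.2 0, funext fun p => ?_⟩
    change _ = (messagePoly 2 0 1 M).eval _
    rw [eval_messagePoly]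
    simp
  · rintro ⟨a, rfl⟩
    refine ⟨(0, fun _ => a), funext fun p => ?_⟩
    change (messagePoly 2 0 1 _).eval _ = _
    rw [eval_messagePoly]
    simp

theorem finrank_range_const {F : Type*} [Field F] {κ : Type*} [Nonempty κ] (E : F →ₗ[F] (κ → F))
    (hE : ∀ a x, E a x = a) : Module.finrank F (LinearMap.range E) = 1 := by
  rw [LinearMap.finrank_range_of_inj, Module.finrank_self]
  intro a b h
  rw [← hE a (Classical.arbitrary κ), h, hE]

theorem cube_root_sum_eq_zero {α : Fˣ} (hα : ∀ x : Fˣ, x ∈ Subgroup.zpowers α)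
    (h3 : 3 ∣ Fintype.card F - 1) :
    ∑ l : Fin 3, (α : F) ^ ((Fintype.card F - 1) / 3 * (l : ℕ)) = 0 := by
  set β := (α : F) ^ ((Fintype.card F - 1) / 3) with hβ
  have hF := Fintype.one_lt_card (α := F)
  have h1 : β ^ 3 = 1 := by
    simpa [hβ] using congrArg Units.val (pow_card_sub_one_div_three α h3)
  have h2 : β ≠ 1 := by
    intro h
    have h' : α ^ ((Fintype.card F - 1) / 3) = 1 := Units.ext (by simpa [hβ] using h)
    have := orderOf_le_of_pow_eq_one (by omega) h'
    rw [orderOf_primitive hα] at this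
    omega
  have h4 : (β - 1) * (1 + β + β ^ 2) = 0 := by linear_combination h1
  simp only [pow_mul, ← hβ, Fin.sum_univ_three]
  simpa using (mul_eq_zero.1 h4).resolve_left (sub_ne_zero.2 h2)

/-- A matrix whose rows are nonzero with supports in distinct blocks has full rank. -/
theorem rank_eq_card_of_block_support {F κ ι : Type*} [Field F] [Fintype κ] [Fintype ι] (H : Matrix κ ι F)
    (b : ι → κ) (hb : Function.Surjective b) (hH : ∀ i p, H i p ≠ 0 ↔ b p = i) :
    H.rank = Fintype.card κ := by
  refine LinearIndependent.rank_matrix (Fintype.linearIndependent_iff.2 fun g hg i => ?_)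
  obtain ⟨p, rfl⟩ := hb i
  have h := congrFun hg p
  rw [Finset.sum_apply, Finset.sum_eq_single (b p)] at h
  · exact (mul_eq_zero.1 h).resolve_right ((hH _ p).2 rfl)
  · intro j _ hj
    have : H j p = 0 := by
      by_contra h
      exact hj ((hH j p).1 h).symm
    simp [Matrix.row, this]
  · simp

theorem repetition_isMR {m : ℕ} (hm : 0 < m) (h3 : 3 ∣ Fintype.card F - 1) {α : Fˣ}
    (hα : ∀ x : Fˣ, x ∈ Subgroup.zpowers α) (T : Finset (Fin ((Fintype.card F - 1) / 3)))
    (hT : T.card + m = (Fintype.card F - 1) / 3) :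
    IsLinearCode (3 * m) 1 (puncturedTamoBarg α 0 T) ∧
      ∃ H₀ : Matrix {i // i ∉ T}
          ({p | p.1 ∉ T} : Finset (Fin ((Fintype.card F - 1) / 3) × Fin (2 + 1))) F,
        (∀ i p, H₀ i p ≠ 0 ↔ p.1.1 = i.1) ∧
        IsMRWithRespectTo H₀ 1 (puncturedTamoBarg α 0 T) := by
  have hκ : Fintype.card {i // i ∉ T} = m := by
    rw [Fintype.card_subtype_compl, Fintype.card_fin, Fintype.card_coe]
    omega
  let e : ({p | p.1 ∉ T} : Finset (Fin ((Fintype.card F - 1) / 3) × Fin (2 + 1))) ≃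
      {i // i ∉ T} × Fin (2 + 1) :=
    { toFun := fun p => (⟨p.1.1, (Finset.mem_filter.1 p.2).2⟩, p.1.2)
      invFun := fun a => ⟨(a.1.1, a.2), by simpa using a.1.2⟩
      left_inv := fun p => rfl
      right_inv := fun a => rfl }
  have hcard : Fintype.card
      ({p | p.1 ∉ T} : Finset (Fin ((Fintype.card F - 1) / 3) × Fin (2 + 1))) = 3 * m := by
    rw [Fintype.card_congr e, Fintype.card_prod, hκ, Fintype.card_fin, mul_comm]
  have hne : Nonempty
      ({p | p.1 ∉ T} : Finset (Fin ((Fintype.card F - 1) / 3) × Fin (2 + 1))) :=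
    Fintype.card_pos_iff.1 (by omega)
  have hcode : puncturedTamoBarg α 0 T = _ :=
    (congrArg (fun C => restrictTo C _) (tamoBargCode_zero α _)).trans (restrictTo_range _ _)
  have hrank : Module.finrank F (puncturedTamoBarg α 0 T) = 1 := by
    rw [hcode]
    exact finrank_range_const _ fun a x => by simp [LinearMap.funLeft]
  refine ⟨⟨hcard, hrank⟩,
    -- Each row carries `1, β, β ^ 2` on its coset, for a primitive cube root of unity `β`: nonzero
    -- entries with sum zero, so constant words are annihilated.
    fun i p => if p.1.1 = i.1 then (α : F) ^ ((Fintype.card F - 1) / 3 * (p.1.2 : ℕ)) else 0,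
    fun i p => by simp, ?_, hrank, by omega, ?_, ?_⟩
  · refine rank_eq_card_of_block_support _ (fun p => (e p).1) (fun i => ⟨e.symm (i, 0), by simp⟩)
      fun i p => ?_
    simp [e, Subtype.ext_iff]
  · intro c hc
    rw [hcode] at hc
    obtain ⟨a, rfl⟩ := hc
    funext i
    simp only [Matrix.mulVec, dotProduct]
    rw [← e.symm.sum_comp, Fintype.sum_prod_type,
      Finset.sum_eq_single i]
    · have := cube_root_sum_eq_zero hα h3
      simpa [e, LinearMap.funLeft, ← Finset.sum_mul] using Or.inl this
    · intro j _ hj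
      have : (j : Fin ((Fintype.card F - 1) / 3)) ≠ i := fun h => hj (Subtype.ext h)
      simp [e, this]
    · simp
  · intro S hS _
    have hS' : Nonempty S := Fintype.card_pos_iff.1 (by rw [Fintype.card_coe]; omega)
    rw [hcode, restrictTo_range]
    exact finrank_range_const _ fun a x => by simp [LinearMap.funLeft]

end repetition

theorem mainTheorem12 :
    -- existence above the explicit field-size threshold
    (∀ N D : ℕ, 0 < N → 0 < D → (2 * D : ℚ) / N < 2 / 3 → 3 ∣ N →
      ∀ (F : Type*) [Field F] [Fintype F], 3 ∣ Fintype.card F - 1 →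
        fieldSizeThreshold N D < (Fintype.card F : ℤ) → HasMRPuncturing F N D) ∧
    -- the resulting field size for `N = 3 m`, `2 D = (2 - y) m`, `0 < y < 2`
    (∃ K : ℝ, 0 < K ∧ ∀ (m D : ℕ) (y : ℝ), 0 < m → 0 < y → y < 2 → (2 * D : ℝ) = (2 - y) * m →
      ∃ q : ℕ, IsPrimePow q ∧ 3 ∣ q - 1 ∧ fieldSizeThreshold (3 * m) D < (q : ℤ) ∧
        (y ≤ 1 → (q : ℝ) ≤ K * (((m : ℝ) - 1) * 4 ^ (m - 1))) ∧
        (1 < y → (q : ℝ) ≤ K * ((m : ℝ) ^ 2 * growthE1 y ^ m)) ∧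
        ∀ (F : Type*) [Field F] [Fintype F], Fintype.card F = q → HasMRPuncturing F (3 * m) D) ∧
    -- the case `y = 2`, that is `k = 1`
    (∀ m : ℕ, 0 < m → ∀ (F : Type*) [Field F] [Fintype F], 3 ∣ Fintype.card F - 1 →
      3 * m + 1 ≤ Fintype.card F → ∀ α : Fˣ, (∀ x : Fˣ, x ∈ Subgroup.zpowers α) →
      ∀ T : Finset (Fin ((Fintype.card F - 1) / 3)), T.card + m = (Fintype.card F - 1) / 3 →
        IsLinearCode (3 * m) 1 (puncturedTamoBarg α 0 T) ∧
        ∃ H₀ : Matrix {i // i ∉ T}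
            ({p | p.1 ∉ T} : Finset (Fin ((Fintype.card F - 1) / 3) × Fin (2 + 1))) F,
          (∀ i p, H₀ i p ≠ 0 ↔ p.1.1 = i.1) ∧
          IsMRWithRespectTo H₀ 1 (puncturedTamoBarg α 0 T)) ∧
    -- comparison of the exponential growth rates for rates up to about `0.233`
    (∀ y : ℝ, 1.3 ≤ y → y < 2 → growthE1 y < 4 ∧ growthE1 y < growthE2 y) := by
  -- `24 = 4 * 6`: the loss from powers of 4 times the constant of `threshold_le_four_pow`; the
  -- other range needs only `4 * 3`.
  refine ⟨?_, ⟨24, by norm_num, ?_⟩, ?_, ?_⟩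
  · rintro N D hN hD hlt ⟨m, rfl⟩ F _ _ h3 hq
    refine hasMRPuncturing_of_threshold hD ?_ h3 hq
    rw [div_lt_div_iff₀ (by exact_mod_cast hN) (by norm_num)] at hlt
    push_cast at hlt
    have : (D : ℚ) < m := by linarith
    exact_mod_cast this
  · intro m D y hm hy0 hy2 hy
    have hm' : (0 : ℝ) < m := by exact_mod_cast hm
    have hD : 0 < D := by
      have : (0 : ℝ) < D := by nlinarith
      exact_mod_cast this
    have hDm : D < m := by
      have : (D : ℝ) < m := by nlinarith
      exact_mod_cast this
    obtain ⟨q, hq, h3, hlt, hle⟩ := exists_primePow_above_threshold hm D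
    refine ⟨q, hq, h3, hlt, fun _ => ?_, fun hy1 => ?_, ?_⟩
    -- `0 < D < m` forces `m ≥ 2`, so the factor `m - 1` in the bound is positive.
    · have := threshold_le_four_pow (m := m) (by omega) D
      linarith
    · have h1 := threshold_le_growth hD hy1 hy2 hy
      have h2 : (1 : ℝ) ≤ fieldSizeThreshold (3 * m) D := by
        exact_mod_cast one_le_fieldSizeThreshold hm D
      linarith
    · rintro F _ _ rfl
      exact hasMRPuncturing_of_threshold hD hDm h3 hlt
  · intro m hm F _ _ h3 _ α hα T hT
    exact repetition_isMR hm h3 hα T hT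
  · intro y h1 h2
    refine ⟨growthE1_lt_four h1 h2, growthE1_lt_growthE2 ?_ h2⟩
    norm_num at h1
    linarith
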